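/- Let $1<\alpha<2$ and $\lambda\ge 0$, and let $u\in C^7(\mathbb R)$ be real-valued with $u^{(k)}\in L^1(\mathbb R)$ for $k=0,1,\dots,7$. Let $${}_{-\infty}D_x^{\alpha,\lambda}u(x)=\frac{e^{-\lambda x}}{\Gamma(2-\alpha)}\frac{d^2}{dx^2}\int_{-\infty}^x (x-s)^{1-\alpha}e^{\lambda s}u(s)\,ds$$ be the left tempered Riemann--Liouville derivative of order $\alpha$. For $h>0$ and $p\in\mathbb Z$ let $$\Delta_p^{\alpha,\lambda}u(x)=\frac1{h^\alpha}\sum_{k=0}^\infty g_k^{(\alpha)}e^{-(k-p)\lambda h}u(x-(k-p)h),\qquad g_k^{(\alpha)}=\frac{\Gamma(k-\alpha)}{\Gamma(-\alpha)\Gamma(k+1)},$$ be the left shifted tempered Grünwald--Letnikov operators. Put $\delta_x^2f(x)=\big(f(x-h)-2f(x)+f(x+h)\big)/h^2$, $$b_2^\alpha=\frac{4+\alpha-\alpha^2}{24},\quad \mu_1=\frac{(1+\alpha)(2+\alpha)}{12},\quad \mu_0=-\frac{(-2+\alpha)(2+\alpha)}{6},\quad \mu_{-1}=\frac{(-2+\alpha)(-1+\alpha)}{12},$$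 and $P_x^\lambda v(x)=v(x)+h^2b_2^\alpha e^{-\lambda x}\,\delta_x^2\big(e^{\lambda x}v(x)\big)$. Then the integral defining ${}_{-\infty}D_x^{\alpha,\lambda}u$ converges absolutely for every $x$ and is a twice differentiable function of $x\in\mathbb R$, the series defining $\Delta_p^{\alpha,\lambda}u(x)$ converges absolutely for all $p\in\mathbb Z$, $h>0$, $x\in\mathbb R$, and, as $h\to0^+$, $$P_x^\lambda\,{}_{-\infty}D_x^{\alpha,\lambda}u(x)=\mu_1\Delta_1^{\alpha,\lambda}u(x)+\mu_0\Delta_0^{\alpha,\lambda}u(x)+\mu_{-1}\Delta_{-1}^{\alpha,\lambda}u(x)+O(h^4)$$ uniformly in $x\in\mathbb R$; that is, there are $C$ and $h_0>0$, depending only on $u,\alpha,\lambda$, such that the difference of the two sides is at most $Ch^4$ in absolute value for all $0<h\le h_0$ and all $x\in\mathbb R$. -/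

import Mathlib

open MeasureTheory

noncomputable section

/-- The integer `n` with `n - 1 < α < n` (for non-integer `α > 0`). -/
def rlOrder (α : ℝ) : ℕ := ⌊α⌋₊ + 1

/-- The integrand `s ↦ (x - s)^(n - α - 1) f(s)` of the left Riemann-Liouville derivative. -/
def rlIntegrand (α : ℝ) (f : ℝ → ℝ) (x s : ℝ) : ℝ :=
  (x - s) ^ ((rlOrder α : ℝ) - α - 1) * f s

/-- The function `x ↦ ∫_{-∞}^x (x - s)^(n - α - 1) f(s) ds`. -/
def rlIntegral (α : ℝ) (f : ℝ → ℝ) (x : ℝ) : ℝ :=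
  ∫ s in Set.Iic x, rlIntegrand α f x s

/-- The left Riemann-Liouville derivative of order `α` on the whole line,
`(1 / Γ(n - α)) dⁿ/dxⁿ ∫_{-∞}^x (x - s)^(n - α - 1) f(s) ds`. -/
def leftRL (α : ℝ) (f : ℝ → ℝ) (x : ℝ) : ℝ :=
  1 / Real.Gamma ((rlOrder α : ℝ) - α) * iteratedDeriv (rlOrder α) (rlIntegral α f) x

/-- The left Riemann-Liouville derivative of `f` of order `α` exists at every point: the integrals
converge absolutely and the resulting function is `n` times differentiable. -/
def LeftRLExists (α : ℝ) (f : ℝ → ℝ) : Prop :=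
  (∀ x : ℝ, IntegrableOn (rlIntegrand α f x) (Set.Iic x)) ∧
    ∀ m < rlOrder α, Differentiable ℝ (iteratedDeriv m (rlIntegral α f))

/-- Multiplication by the exponential: `x ↦ e^{λ x} f(x)`. -/
def expMul (lam : ℝ) (f : ℝ → ℝ) (x : ℝ) : ℝ := Real.exp (lam * x) * f x

/-- The left tempered Riemann-Liouville derivative `e^{-λ x} D^α (e^{λ x} u(x))`. -/
def leftTemperedRL (α lam : ℝ) (u : ℝ → ℝ) (x : ℝ) : ℝ :=
  Real.exp (-lam * x) * leftRL α (expMul lam u) x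

/-- The Grünwald weights `Γ(k - α) / (Γ(-α) Γ(k + 1))`. -/
def grunwaldWeight (α : ℝ) (k : ℕ) : ℝ :=
  Real.Gamma ((k : ℝ) - α) / (Real.Gamma (-α) * Real.Gamma ((k : ℝ) + 1))

/-- The `k`-th term `g_k e^{-(k - p) λ h} u(x - (k - p) h)` of the shifted tempered Grünwald sum. -/
def grunwaldTerm (α lam h : ℝ) (p : ℤ) (u : ℝ → ℝ) (x : ℝ) (k : ℕ) : ℝ :=
  grunwaldWeight α k * Real.exp (-((k : ℝ) - (p : ℝ)) * lam * h) * u (x - ((k : ℝ) - (p : ℝ)) * h)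

/-- The left shifted tempered Grünwald-Letnikov operator with step `h` and shift `p`. -/
def temperedGrunwald (α lam h : ℝ) (p : ℤ) (u : ℝ → ℝ) (x : ℝ) : ℝ :=
  1 / h ^ α * ∑' k : ℕ, grunwaldTerm α lam h p u x k

/-- The centered second difference operator with step `h`. -/
def centeredDiff (h : ℝ) (f : ℝ → ℝ) (x : ℝ) : ℝ :=
  (f (x - h) - 2 * f x + f (x + h)) / h ^ 2

def coeffB (α : ℝ) : ℝ := (4 + α - α ^ 2) / 24

def coeffMuOne (α : ℝ) : ℝ := (1 + α) * (2 + α) / 12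

def coeffMuZero (α : ℝ) : ℝ := -(-2 + α) * (2 + α) / 6

def coeffMuNegOne (α : ℝ) : ℝ := (-2 + α) * (-1 + α) / 12

/-- The tempered quasi-compact operator `P^λ v = v + h² b e^{-λ x} δ² (e^{λ x} v)`. -/
def temperedP (α lam h : ℝ) (v : ℝ → ℝ) (x : ℝ) : ℝ :=
  v x + h ^ 2 * coeffB α * Real.exp (-lam * x) * centeredDiff h (expMul lam v) x

end

/-!
Since `u` and its derivatives are integrable, `𝓕 u` decays like a power of `1 + |ω|`, and
`x ↦ exp (lam * x) * u x` is a superposition of the exponentials `x ↦ exp (z * x)` over the line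
`Re z = lam`. Every operator of the theorem, conjugated by `exp (lam * x)`, multiplies each of these
exponentials by a symbol: the derivative by `z ^ α`, the Grünwald operator with shift `p` by
`h ^ (-α) * (1 - exp (-h * z)) ^ α * exp (p * h * z)`. Hence the truncation error has the symbol
`h ^ (-α) * E (h * z)` for a fixed function `E`. The coefficients of the scheme make
`E ζ = O(ζ ^ (α + 4))` as `ζ → 0` in the right half-plane, and on a vertical strip `E ζ` is at most
of order `1 + |ζ| ^ α`, so there the bound `|ζ| ^ (α + 4)` holds globally; integrated against `𝓕 u`
it gives the rate `h ^ 4`.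
-/

noncomputable section

open Complex Filter Set Topology Asymptotics
open scoped Real FourierTransform

section LaplaceTransform

variable {a r : ℂ}

theorem norm_cpow_mul_cexp_neg_mul (a r : ℂ) {t : ℝ} (ht : 0 < t) :
    ‖(t : ℂ) ^ a * cexp (-(r * t))‖ = t ^ a.re * Real.exp (-r.re * t) := by
  simp [norm_cpow_eq_rpow_re_of_pos ht, norm_exp]

theorem integrableOn_cpow_mul_cexp_neg_mul_Ioi (ha : -1 < a.re) (hr : 0 < r.re) :
    IntegrableOn (fun t : ℝ ↦ (t : ℂ) ^ a * cexp (-(r * t))) (Ioi 0) := by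
  have hdom : IntegrableOn (fun t : ℝ ↦ t ^ a.re * Real.exp (-r.re * t)) (Ioi 0) := by
    simpa using integrableOn_rpow_mul_exp_neg_mul_rpow (p := 1) ha zero_lt_one hr
  refine hdom.mono' (by fun_prop) ?_
  filter_upwards [ae_restrict_mem measurableSet_Ioi] with t ht
  exact (norm_cpow_mul_cexp_neg_mul a r ht).le

theorem hasDerivAt_integral_cpow_mul_cexp_neg_mul_Ioi (ha : -1 < a.re) (hr : 0 < r.re) :
    HasDerivAt (fun r : ℂ ↦ ∫ t : ℝ in Ioi 0, (t : ℂ) ^ a * cexp (-(r * t)))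
      (∫ t : ℝ in Ioi 0, (t : ℂ) ^ a * (cexp (-(r * t)) * -t)) r := by
  have hdom : IntegrableOn (fun t : ℝ ↦ t ^ (a.re + 1) * Real.exp (-(r.re / 2) * t)) (Ioi 0) := by
    simpa using integrableOn_rpow_mul_exp_neg_mul_rpow (s := a.re + 1) (p := 1) (by linarith)
      zero_lt_one (half_pos hr)
  have hnhds : {w : ℂ | r.re / 2 < w.re} ∈ 𝓝 r :=
    (isOpen_lt continuous_const continuous_re).mem_nhds (half_lt_self hr)
  refine (hasDerivAt_integral_of_dominated_loc_of_deriv_le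
    (F := fun (w : ℂ) (t : ℝ) ↦ (t : ℂ) ^ a * cexp (-(w * t)))
    (F' := fun (w : ℂ) (t : ℝ) ↦ (t : ℂ) ^ a * (cexp (-(w * t)) * -t)) hnhds
    (.of_forall fun w ↦ by fun_prop) (integrableOn_cpow_mul_cexp_neg_mul_Ioi ha hr) (by fun_prop)
    ?_ hdom (.of_forall fun t w _ ↦ ?_)).2
  · filter_upwards [ae_restrict_mem measurableSet_Ioi] with t (ht : 0 < t) w (hw : r.re / 2 < w.re)
    rw [← mul_assoc, norm_mul, norm_cpow_mul_cexp_neg_mul a w ht, norm_neg, norm_real,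
      Real.norm_of_nonneg ht.le, mul_right_comm, ← Real.rpow_add_one ht.ne']
    gcongr
  · simpa using (((hasDerivAt_id w).mul_const (t : ℂ)).neg.cexp).const_mul ((t : ℂ) ^ a)

theorem integral_cpow_mul_cexp_neg_mul_Ioi (ha : 0 < a.re) (hr : 0 < r.re) :
    ∫ t : ℝ in Ioi 0, (t : ℂ) ^ (a - 1) * cexp (-(r * t)) = Complex.Gamma a * r ^ (-a) := by
  have hopen : IsOpen {r : ℂ | 0 < r.re} := isOpen_lt continuous_const continuous_re
  have hlaplace : AnalyticOnNhd ℂ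
      (fun r : ℂ ↦ ∫ t : ℝ in Ioi 0, (t : ℂ) ^ (a - 1) * cexp (-(r * t))) {r | 0 < r.re} :=
    DifferentiableOn.analyticOnNhd (fun r hr ↦ (hasDerivAt_integral_cpow_mul_cexp_neg_mul_Ioi
      (by simpa using ha) hr).differentiableAt.differentiableWithinAt) hopen
  have hpow : AnalyticOnNhd ℂ (fun r : ℂ ↦ Complex.Gamma a * r ^ (-a)) {r | 0 < r.re} :=
    fun r hr ↦ analyticAt_const.mul (analyticAt_id.cpow analyticAt_const (Or.inl hr))
  have hreal : ∀ c : ℝ, 0 < c → ∫ t : ℝ in Ioi 0, (t : ℂ) ^ (a - 1) * cexp (-(c * t)) =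
      Complex.Gamma a * (c : ℂ) ^ (-a) := fun c hc ↦ by
    rw [integral_cpow_mul_exp_neg_mul_Ioi ha hc, one_div, ← ofReal_inv, mul_comm, ofReal_inv,
      inv_cpow _ _ (by simp [arg_ofReal_of_nonneg hc.le, Real.pi_ne_zero.symm]), cpow_neg]
  refine hlaplace.eqOn_of_preconnected_of_frequently_eq hpow
    (convex_halfSpace_re_gt 0).isPreconnected (z₀ := 1) (by simp) ?_ hr
  have hlim : Tendsto ((↑) : ℝ → ℂ) (𝓝[≠] 1) (𝓝[≠] 1) :=
    tendsto_nhdsWithin_iff.2 ⟨(continuous_ofReal.tendsto' 1 1 ofReal_one).mono_left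
      nhdsWithin_le_nhds, eventually_nhdsWithin_of_forall fun c hc ↦ by simpa using hc⟩
  refine hlim.frequently (Eventually.frequently ?_)
  filter_upwards [nhdsWithin_le_nhds (lt_mem_nhds one_pos)] with c hc using hreal c hc

end LaplaceTransform

section LaplaceLine

/-- The point of frequency `ω` on the vertical line `Re z = lam`. With the factor `2π` of Mathlib's
Fourier transform, the function `exp (lam * x) * f x` is the superposition of the exponentials
`x ↦ exp (laplaceLine lam ω * x)` with the weights `𝓕 f ω`. -/
def laplaceLine (lam ω : ℝ) : ℂ := lam + 2 * π * ω * I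

variable (lam ω x : ℝ)

@[simp]
theorem laplaceLine_re : (laplaceLine lam ω).re = lam := by simp [laplaceLine]

@[simp]
theorem laplaceLine_im : (laplaceLine lam ω).im = 2 * π * ω := by simp [laplaceLine]

theorem laplaceLine_eq_add : laplaceLine lam ω = lam + laplaceLine 0 ω := by simp [laplaceLine]

@[fun_prop]
theorem continuous_laplaceLine_comp {X : Type*} [TopologicalSpace X] {f g : X → ℝ}
    (hf : Continuous f) (hg : Continuous g) : Continuous fun x ↦ laplaceLine (f x) (g x) := by
  unfold laplaceLine; fun_prop

theorem laplaceLine_ne_zero {ω : ℝ} (hω : ω ≠ 0) : laplaceLine lam ω ≠ 0 := fun h ↦ by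
  simpa [hω, Real.pi_ne_zero] using congrArg im h

theorem abs_le_norm_laplaceLine : |ω| ≤ ‖laplaceLine lam ω‖ := by
  refine le_trans ?_ (abs_im_le_norm _)
  rw [laplaceLine_im, abs_mul, abs_of_pos Real.two_pi_pos]
  exact le_mul_of_one_le_left (abs_nonneg ω) (by linarith [Real.pi_gt_three])

theorem norm_laplaceLine_zero_le : ‖laplaceLine 0 ω‖ ≤ ‖laplaceLine lam ω‖ := by
  refine le_trans (le_of_eq ?_) (abs_im_le_norm _)
  simp [laplaceLine, abs_of_pos Real.pi_pos]

theorem norm_laplaceLine_le : ‖laplaceLine lam ω‖ ≤ (|lam| + 2 * π) * (1 + |ω|) := by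
  have htriangle : ‖laplaceLine lam ω‖ ≤ |lam| + 2 * π * |ω| := by
    simpa [laplaceLine, abs_of_pos Real.pi_pos] using norm_add_le (lam : ℂ) (2 * π * ω * I)
  nlinarith [mul_nonneg (abs_nonneg lam) (abs_nonneg ω), Real.pi_pos]

@[simp]
theorem norm_cexp_laplaceLine_mul : ‖cexp (laplaceLine lam ω * x)‖ = Real.exp (lam * x) := by
  rw [norm_exp, re_mul_ofReal, laplaceLine_re]

theorem hasDerivAt_cexp_mul_ofReal (z : ℂ) :
    HasDerivAt (fun x : ℝ ↦ cexp (z * x)) (z * cexp (z * x)) x := by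
  simpa [mul_comm] using ((ofRealCLM.hasDerivAt (x := x)).const_mul z).cexp

end LaplaceLine

/-- `HasSymbol lam φ m F` says that `F` is obtained from the superposition of exponentials
`x ↦ ∫ ω, φ ω * exp (z * x)` over the line `z = laplaceLine lam ω` by applying the multiplier with
symbol `m`, that is, by multiplying each `exp (z * x)` by `m z`. Absolute convergence is part of the
notion. -/
structure HasSymbol (lam : ℝ) (φ : ℝ → ℂ) (m : ℂ → ℂ) (F : ℝ → ℂ) : Prop where
  integrable : Integrable fun ω ↦ m (laplaceLine lam ω) * φ ω
  eq_integral : ∀ x : ℝ,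
    F x = ∫ ω, m (laplaceLine lam ω) * φ ω * cexp (laplaceLine lam ω * x)

namespace HasSymbol

variable {lam : ℝ} {φ : ℝ → ℂ} {m m' : ℂ → ℂ} {F G : ℝ → ℂ}

theorem integrable_mul_cexp (hF : HasSymbol lam φ m F) (x : ℝ) :
    Integrable fun ω ↦ m (laplaceLine lam ω) * φ ω * cexp (laplaceLine lam ω * x) :=
  hF.integrable.mul_bdd (c := Real.exp (lam * x))
    (Continuous.aestronglyMeasurable (by fun_prop)) (.of_forall fun ω ↦ by simp)

theorem add (hF : HasSymbol lam φ m F) (hG : HasSymbol lam φ m' G) :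
    HasSymbol lam φ (fun z ↦ m z + m' z) (fun x ↦ F x + G x) where
  integrable := by simpa only [add_mul, Pi.add_def] using hF.integrable.add hG.integrable
  eq_integral x := by
    simp only [hF.eq_integral x, hG.eq_integral x, add_mul]
    exact (integral_add (hF.integrable_mul_cexp x) (hG.integrable_mul_cexp x)).symm

theorem const_mul (hF : HasSymbol lam φ m F) (c : ℂ) :
    HasSymbol lam φ (fun z ↦ c * m z) (fun x ↦ c * F x) where
  integrable := by simpa only [mul_assoc] using hF.integrable.const_mul c
  eq_integral x := by simp only [hF.eq_integral x, mul_assoc, integral_const_mul]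

theorem sub (hF : HasSymbol lam φ m F) (hG : HasSymbol lam φ m' G) :
    HasSymbol lam φ (fun z ↦ m z - m' z) (fun x ↦ F x - G x) := by
  simpa only [neg_one_mul, ← sub_eq_add_neg] using hF.add (hG.const_mul (-1))

theorem translate (hF : HasSymbol lam φ m F) (a : ℝ) :
    HasSymbol lam φ (fun z ↦ cexp (z * a) * m z) (fun x ↦ F (x + a)) where
  integrable := (hF.integrable_mul_cexp a).congr (.of_forall fun ω ↦ by ring)
  eq_integral x := by
    rw [hF.eq_integral]
    refine integral_congr_ae (.of_forall fun ω ↦ ?_)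
    simp only [ofReal_add, mul_add, Complex.exp_add]
    ring

theorem congr (hF : HasSymbol lam φ m F) (hm : ∀ z : ℂ, z.re = lam → z ≠ 0 → m z = m' z) :
    HasSymbol lam φ m' F := by
  have hae : ∀ᵐ ω : ℝ, m (laplaceLine lam ω) = m' (laplaceLine lam ω) := by
    filter_upwards [volume.ae_ne 0] with ω hω
    exact hm _ (laplaceLine_re lam ω) (laplaceLine_ne_zero lam hω)
  refine ⟨hF.integrable.congr ?_, fun x ↦ (hF.eq_integral x).trans (integral_congr_ae ?_)⟩ <;>
    filter_upwards [hae] with ω hω <;> simp only [hω]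

theorem exp_mul {f : ℝ → ℂ} (hf : HasSymbol 0 φ 1 f) (lam : ℝ) :
    HasSymbol lam φ 1 fun x ↦ cexp (lam * x) * f x where
  integrable := by simpa using hf.integrable
  eq_integral x := by
    rw [hf.eq_integral, ← integral_const_mul]
    refine integral_congr_ae (.of_forall fun ω ↦ ?_)
    simp only [laplaceLine_eq_add lam ω, add_mul, Complex.exp_add, Pi.one_apply]
    ring

theorem norm_le (hF : HasSymbol lam φ m F) {g : ℝ → ℝ} (hg : Integrable g)
    (hmg : ∀ ω, ‖m (laplaceLine lam ω) * φ ω‖ ≤ g ω) (x : ℝ) :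
    ‖F x‖ ≤ Real.exp (lam * x) * ∫ ω, g ω := by
  rw [hF.eq_integral, ← integral_const_mul]
  refine norm_integral_le_of_norm_le (hg.const_mul _) (.of_forall fun ω ↦ ?_)
  rw [norm_mul, norm_cexp_laplaceLine_mul, mul_comm]
  exact mul_le_mul_of_nonneg_left (hmg ω) (Real.exp_pos _).le

theorem hasDerivAt (hF : HasSymbol lam φ m F) (hG : HasSymbol lam φ (fun z ↦ z * m z) G)
    (x : ℝ) : HasDerivAt F (G x) x := by
  rw [funext hF.eq_integral, hG.eq_integral]
  refine (hasDerivAt_integral_of_dominated_loc_of_deriv_le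
    (bound := fun ω ↦ ‖laplaceLine lam ω * m (laplaceLine lam ω) * φ ω‖ *
      Real.exp (|lam| * (|x| + 1)))
    (F' := fun y ω ↦ laplaceLine lam ω * m (laplaceLine lam ω) * φ ω *
      cexp (laplaceLine lam ω * (y : ℝ)))
    (Metric.ball_mem_nhds x one_pos)
    (.of_forall fun y ↦ (hF.integrable_mul_cexp y).aestronglyMeasurable)
    (hF.integrable_mul_cexp x) (hG.integrable_mul_cexp x).aestronglyMeasurable
    (.of_forall fun ω y hy ↦ ?_) (hG.integrable.norm.mul_const _) (.of_forall fun ω y _ ↦ ?_)).2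
  · have hy : |y| ≤ |x| + 1 := by
      have := abs_sub_abs_le_abs_sub y x
      rw [Metric.mem_ball, Real.dist_eq] at hy
      linarith
    rw [norm_mul, norm_cexp_laplaceLine_mul]
    refine mul_le_mul_of_nonneg_left (Real.exp_le_exp.2 ?_) (norm_nonneg _)
    calc lam * y ≤ |lam| * |y| := by rw [← abs_mul]; exact le_abs_self _
      _ ≤ |lam| * (|x| + 1) := by gcongr
  · convert! (hasDerivAt_cexp_mul_ofReal y (laplaceLine lam ω)).const_mul
      (m (laplaceLine lam ω) * φ ω) using 1
    ring

end HasSymbol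

namespace HasSymbol

variable {lam : ℝ} {φ : ℝ → ℂ} {m : ℂ → ℂ} {F f : ℝ → ℂ}

section Series

variable {ι : Type*} [Countable ι] {c : ι → ℂ} {a : ι → ℝ} {w : ℂ → ℂ}

theorem hasSum_translate (hF : HasSymbol lam φ m F) (hlam : 0 ≤ lam) (ha : ∀ k, 0 ≤ a k)
    (hc : Summable fun k ↦ ‖c k‖)
    (hw : ∀ z : ℂ, z.re = lam → HasSum (fun k ↦ c k * cexp (-(z * a k))) (w z)) (x : ℝ) :
    HasSum (fun k ↦ c k * F (x - a k)) (∫ ω, w (laplaceLine lam ω) * m (laplaceLine lam ω) * φ ω *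
      cexp (laplaceLine lam ω * x)) := by
  have hterm (k : ι) := (hF.translate (-a k)).const_mul (c k)
  have hsum : Summable fun k ↦ ∫ ω, ‖c k * (cexp (laplaceLine lam ω * (-a k : ℝ)) *
      m (laplaceLine lam ω)) * φ ω * cexp (laplaceLine lam ω * x)‖ := by
    refine Summable.of_nonneg_of_le (fun k ↦ integral_nonneg fun ω ↦ norm_nonneg _) (fun k ↦ ?_)
      (hc.mul_right (∫ ω, ‖m (laplaceLine lam ω) * φ ω * cexp (laplaceLine lam ω * x)‖))
    rw [← integral_const_mul]
    refine integral_mono ((hterm k).integrable_mul_cexp x).norm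
      ((hF.integrable_mul_cexp x).norm.const_mul _) fun ω ↦ ?_
    have hexp : Real.exp (lam * -a k) ≤ 1 :=
      Real.exp_le_one_iff.2 (mul_nonpos_of_nonneg_of_nonpos hlam (neg_nonpos.2 (ha k)))
    simp only [norm_mul, norm_cexp_laplaceLine_mul, mul_assoc]
    exact mul_le_mul_of_nonneg_left (mul_le_of_le_one_left (by positivity) hexp) (norm_nonneg _)
  convert! hasSum_integral_of_summable_integral_norm
    (fun k ↦ (hterm k).integrable_mul_cexp x) hsum using 1
  · exact funext fun k ↦ (hterm k).eq_integral x
  · refine integral_congr_ae (.of_forall fun ω ↦ ?_)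
    simp only [tsum_mul_right, ← mul_assoc, ofReal_neg, mul_neg]
    rw [(hw _ (laplaceLine_re lam ω)).tsum_eq]

theorem tsum_translate (hF : HasSymbol lam φ m F) (hlam : 0 ≤ lam) (ha : ∀ k, 0 ≤ a k)
    (hc : Summable fun k ↦ ‖c k‖)
    (hw : ∀ z : ℂ, z.re = lam → HasSum (fun k ↦ c k * cexp (-(z * a k))) (w z)) :
    HasSymbol lam φ (fun z ↦ w z * m z) fun x ↦ ∑' k, c k * F (x - a k) where
  integrable := by
    have hmeas : AEStronglyMeasurable fun ω ↦ w (laplaceLine lam ω) :=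
      aestronglyMeasurable_of_tendsto_ae atTop (fun s ↦ Continuous.aestronglyMeasurable
        (f := fun ω ↦ ∑ k ∈ s, c k * cexp (-(laplaceLine lam ω * a k))) (by fun_prop))
        (.of_forall fun ω ↦ hw _ (laplaceLine_re lam ω))
    have hbound (ω : ℝ) : ‖w (laplaceLine lam ω)‖ ≤ ∑' k, ‖c k‖ := by
      refine (hw _ (laplaceLine_re lam ω)).norm_le_of_bounded hc.hasSum fun k ↦ ?_
      rw [norm_mul, norm_exp]
      refine mul_le_of_le_one_right (norm_nonneg _) (Real.exp_le_one_iff.2 ?_)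
      simpa using mul_nonneg hlam (ha k)
    simpa only [mul_assoc] using hF.integrable.bdd_mul hmeas (.of_forall hbound)
  eq_integral x := (hF.hasSum_translate hlam ha hc hw x).tsum_eq

end Series

end HasSymbol

section WeylIntegral

variable {E : Type*} [NormedAddCommGroup E] [NormedSpace ℝ E] {σ : ℝ}

/-- The Weyl fractional integral of order `σ`, without its normalizing factor `1 / Γ(σ)`. This is
`rlIntegral` after the substitution `s = x - t`, which puts the singularity of the kernel at `0`. -/
def weylIntegral (σ : ℝ) (f : ℝ → E) (x : ℝ) : E :=
  ∫ t in Ioi (0 : ℝ), t ^ (σ - 1) • f (x - t)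

theorem weylIntegral_eq_integral_cpow (σ : ℝ) (f : ℝ → ℂ) (x : ℝ) :
    weylIntegral σ f x = ∫ t : ℝ in Ioi 0, (t : ℂ) ^ ((σ : ℂ) - 1) * f (x - t) := by
  refine setIntegral_congr_fun measurableSet_Ioi fun t (ht : 0 < t) ↦ ?_
  simp only [real_smul, ofReal_cpow ht.le, ofReal_sub, ofReal_one]

theorem ofReal_weylIntegral (σ : ℝ) (f : ℝ → ℝ) (x : ℝ) :
    ((weylIntegral σ f x : ℝ) : ℂ) = weylIntegral σ (fun y ↦ (f y : ℂ)) x := by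
  simp only [weylIntegral, real_smul, smul_eq_mul, ← ofReal_mul, integral_complex_ofReal]

theorem integrableOn_rpow_smul_comp_sub_left {f : ℝ → E} {M : ℝ} (hf : Integrable f)
    (hM : ∀ x, ‖f x‖ ≤ M) (hσ : 0 < σ) (hσ' : σ ≤ 1) (x : ℝ) :
    IntegrableOn (fun t ↦ t ^ (σ - 1) • f (x - t)) (Ioi 0) := by
  have hmeas : AEStronglyMeasurable fun t ↦ t ^ (σ - 1) • f (x - t) :=
    (Measurable.aestronglyMeasurable (by fun_prop)).smul (hf.comp_sub_left x).aestronglyMeasurable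
  rw [← Ioc_union_Ioi_eq_Ioi (zero_le_one (α := ℝ))]
  refine IntegrableOn.union ?_ ?_
  · have hkernel : IntegrableOn (fun t : ℝ ↦ t ^ (σ - 1)) (Ioc 0 1) :=
      (intervalIntegrable_iff_integrableOn_Ioc_of_le zero_le_one).1
        (intervalIntegral.intervalIntegrable_rpow' (by linarith))
    refine (hkernel.mul_const M).mono' hmeas.restrict ?_
    filter_upwards [ae_restrict_mem measurableSet_Ioc] with t ht
    have hpos := Real.rpow_nonneg ht.1.le (σ - 1)
    rw [norm_smul, Real.norm_of_nonneg hpos]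
    exact mul_le_mul_of_nonneg_left (hM _) hpos
  · refine (hf.comp_sub_left x).norm.integrableOn.mono' hmeas.restrict ?_
    filter_upwards [ae_restrict_mem measurableSet_Ioi] with t (ht : 1 < t)
    rw [norm_smul, Real.norm_of_nonneg (by positivity)]
    exact mul_le_of_le_one_left (norm_nonneg _)
      (Real.rpow_le_one_of_one_le_of_nonpos ht.le (by linarith))

theorem norm_cexp_ofReal_mul_le {lam y x : ℝ} (hlam : 0 ≤ lam) (hy : y ≤ x) :
    ‖cexp (lam * y)‖ ≤ Real.exp (lam * x) := by
  rw [← ofReal_mul, norm_exp_ofReal]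
  gcongr

theorem tendsto_weylIntegral_exp_mul {f : ℝ → ℂ} {M : ℝ} (hf : Integrable f) (hM : ∀ x, ‖f x‖ ≤ M)
    (hσ : 0 < σ) (hσ' : σ ≤ 1) (x : ℝ) :
    Tendsto (fun μ : ℝ ↦ weylIntegral σ (fun y ↦ cexp (μ * y) * f y) x) (𝓝[>] 0)
      (𝓝 (weylIntegral σ f x)) := by
  have hint := integrableOn_rpow_smul_comp_sub_left hf hM hσ hσ' x
  refine tendsto_integral_filter_of_dominated_convergence
    (fun t ↦ Real.exp |x| * ‖t ^ (σ - 1) • f (x - t)‖) ?_ ?_ (hint.norm.const_mul _)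
    (.of_forall fun t ↦ ?_)
  · refine .of_forall fun μ ↦ ?_
    have hexp : Continuous fun t : ℝ ↦ cexp (μ * (x - t : ℝ)) := by fun_prop
    simpa only [mul_smul_comm, Pi.mul_def] using
      hexp.aestronglyMeasurable.mul hint.aestronglyMeasurable
  · filter_upwards [Ioo_mem_nhdsGT one_pos] with μ hμ
    filter_upwards [ae_restrict_mem measurableSet_Ioi] with t (ht : 0 < t)
    rw [← mul_smul_comm, norm_mul]
    refine mul_le_mul_of_nonneg_right ((norm_cexp_ofReal_mul_le hμ.1.le (x := |x|) ?_).trans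
      (Real.exp_le_exp.2 ?_)) (norm_nonneg _)
    · linarith [le_abs_self x]
    · exact mul_le_of_le_one_left (abs_nonneg x) hμ.2.le
  · have hcont : Continuous fun μ : ℝ ↦ t ^ (σ - 1) • (cexp (μ * (x - t : ℝ)) * f (x - t)) := by
      fun_prop
    simpa using (hcont.tendsto 0).mono_left nhdsWithin_le_nhds

end WeylIntegral

theorem integral_cpow_mul_cexp_laplaceLine {lam σ : ℝ} (hlam : 0 < lam) (hσ : 0 < σ) (ω : ℝ)
    (c : ℂ) : ∫ t : ℝ in Ioi 0, (t : ℂ) ^ ((σ : ℂ) - 1) * cexp (-(laplaceLine lam ω * t)) * c =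
      Complex.Gamma σ * laplaceLine lam ω ^ (-(σ : ℂ)) * c := by
  rw [integral_mul_const,
    integral_cpow_mul_cexp_neg_mul_Ioi (by simpa using hσ) (by simpa using hlam)]

theorem norm_laplaceLine_cpow_neg_le (lam : ℝ) {σ ω : ℝ} (hσ : 0 ≤ σ) (hω : ω ≠ 0) :
    ‖laplaceLine lam ω ^ (-(σ : ℂ))‖ ≤ ‖laplaceLine 0 ω‖ ^ (-σ) := by
  rw [← ofReal_neg, norm_cpow_real]
  exact Real.rpow_le_rpow_of_nonpos (norm_pos_iff.2 (laplaceLine_ne_zero 0 hω))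
    (norm_laplaceLine_zero_le lam ω) (neg_nonpos.2 hσ)

theorem tendsto_integral_laplaceLine_cpow_neg {φ : ℝ → ℂ} {σ : ℝ} (hσ : 0 ≤ σ)
    (hφ : AEStronglyMeasurable φ)
    (hφσ : Integrable fun ω ↦ ‖laplaceLine 0 ω‖ ^ (-σ) * ‖φ ω‖) (x : ℝ) :
    Tendsto (fun μ : ℝ ↦ ∫ ω, laplaceLine μ ω ^ (-(σ : ℂ)) * φ ω * cexp (laplaceLine μ ω * x))
      (𝓝[>] 0) (𝓝 (∫ ω, laplaceLine 0 ω ^ (-(σ : ℂ)) * φ ω * cexp (laplaceLine 0 ω * x))) := by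
  refine tendsto_integral_filter_of_dominated_convergence _ (.of_forall fun μ ↦ ?_) ?_
    (hφσ.mul_const (Real.exp |x|)) ?_
  · have hline : Measurable (laplaceLine μ) := (by fun_prop : Continuous (laplaceLine μ)).measurable
    exact ((Measurable.aestronglyMeasurable (by fun_prop)).mul hφ).mul
      (Measurable.aestronglyMeasurable (by fun_prop))
  · filter_upwards [Ioo_mem_nhdsGT one_pos] with μ hμ
    filter_upwards [volume.ae_ne 0] with ω hω
    rw [norm_mul, norm_mul, norm_cexp_laplaceLine_mul]
    gcongr
    · exact norm_laplaceLine_cpow_neg_le μ hσ hω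
    · exact (mul_le_mul_of_nonneg_left (le_abs_self x) hμ.1.le).trans
        (mul_le_of_le_one_left (abs_nonneg x) hμ.2.le)
  · filter_upwards [volume.ae_ne 0] with ω hω
    have hline : Continuous fun μ ↦ laplaceLine μ ω := by fun_prop
    have hslit : laplaceLine 0 ω ∈ slitPlane := Or.inr (by simpa [Real.pi_ne_zero] using hω)
    have hcont : ContinuousAt
        (fun μ ↦ laplaceLine μ ω ^ (-(σ : ℂ)) * φ ω * cexp (laplaceLine μ ω * x)) 0 :=
      ((hline.continuousAt.cpow continuousAt_const hslit).mul_const _).mul (by fun_prop)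
    exact hcont.tendsto.mono_left nhdsWithin_le_nhds

namespace HasSymbol

variable {lam σ : ℝ} {φ : ℝ → ℂ} {m : ℂ → ℂ} {f : ℝ → ℂ}

theorem integrable_cpow_mul_cexp_prod (hf : HasSymbol lam φ m f) (hlam : 0 < lam) (hσ : 0 < σ)
    (x : ℝ) : Integrable (Function.uncurry fun t ω : ℝ ↦
      (t : ℂ) ^ ((σ : ℂ) - 1) * cexp (-(laplaceLine lam ω * t)) *
        (m (laplaceLine lam ω) * φ ω * cexp (laplaceLine lam ω * x)))
      ((volume.restrict (Ioi 0)).prod volume) := by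
  have hfreq := hf.integrable_mul_cexp x
  refine ((integrableOn_cpow_mul_cexp_neg_mul_Ioi (a := (σ : ℂ) - 1) (r := lam)
    (by simpa using hσ) (by simpa using hlam)).mul_prod hfreq).mono ?_ (.of_forall fun p ↦ ?_)
  · exact (AEStronglyMeasurable.mul (Measurable.aestronglyMeasurable (by fun_prop))
      (Continuous.aestronglyMeasurable (by fun_prop))).mul hfreq.aestronglyMeasurable.comp_snd
  · simp [Function.uncurry, norm_exp]

theorem weylIntegral_of_pos (hf : HasSymbol lam φ m f) (hlam : 0 < lam) (hσ : 0 < σ) :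
    HasSymbol lam φ (fun z ↦ Complex.Gamma σ * z ^ (-(σ : ℂ)) * m z)
      (weylIntegral σ f) where
  integrable := by
    refine (hf.integrable_cpow_mul_cexp_prod hlam hσ 0).integral_prod_right.congr
      (.of_forall fun ω ↦ ?_)
    simp only [Function.uncurry_apply_pair, integral_cpow_mul_cexp_laplaceLine hlam hσ, ofReal_zero,
      mul_zero, Complex.exp_zero]
    ring
  eq_integral x := by
    rw [weylIntegral_eq_integral_cpow]
    calc ∫ t : ℝ in Ioi 0, (t : ℂ) ^ ((σ : ℂ) - 1) * f (x - t)
      _ = ∫ t : ℝ in Ioi 0, ∫ ω, (t : ℂ) ^ ((σ : ℂ) - 1) * cexp (-(laplaceLine lam ω * t)) *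
          (m (laplaceLine lam ω) * φ ω * cexp (laplaceLine lam ω * x)) := by
        refine integral_congr_ae (.of_forall fun t ↦ ?_)
        simp only [hf.eq_integral, ← integral_const_mul]
        refine integral_congr_ae (.of_forall fun ω ↦ ?_)
        simp only [ofReal_sub, mul_sub, Complex.exp_sub, Complex.exp_neg]
        ring
      _ = ∫ ω, ∫ t : ℝ in Ioi 0, (t : ℂ) ^ ((σ : ℂ) - 1) * cexp (-(laplaceLine lam ω * t)) *
          (m (laplaceLine lam ω) * φ ω * cexp (laplaceLine lam ω * x)) :=
        integral_integral_swap (hf.integrable_cpow_mul_cexp_prod hlam hσ x)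
      _ = _ := by
        refine integral_congr_ae (.of_forall fun ω ↦ ?_)
        simp only [integral_cpow_mul_cexp_laplaceLine hlam hσ]
        ring

theorem weylIntegral_zero (hf : HasSymbol 0 φ 1 f) (hfi : Integrable f) (hσ : 0 < σ) (hσ' : σ ≤ 1)
    (hφσ : Integrable fun ω ↦ ‖laplaceLine 0 ω‖ ^ (-σ) * ‖φ ω‖) :
    HasSymbol 0 φ (fun z ↦ Complex.Gamma σ * z ^ (-(σ : ℂ))) (weylIntegral σ f) where
  integrable := by
    have hφ : AEStronglyMeasurable φ := by simpa using hf.integrable.aestronglyMeasurable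
    have hline : Measurable (laplaceLine 0) := (by fun_prop : Continuous (laplaceLine 0)).measurable
    refine (hφσ.const_mul ‖Complex.Gamma σ‖).mono'
      ((Measurable.aestronglyMeasurable (by fun_prop)).mul hφ) ?_
    filter_upwards [volume.ae_ne 0] with ω hω
    rw [norm_mul, norm_mul, mul_assoc]
    gcongr
    exact norm_laplaceLine_cpow_neg_le 0 hσ.le hω
  eq_integral x := by
    have hφ : Integrable φ := by simpa using hf.integrable
    have hbound (y : ℝ) : ‖f y‖ ≤ ∫ ω, ‖φ ω‖ := by
      simpa using hf.norm_le hφ.norm (fun ω ↦ by simp) y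
    refine tendsto_nhds_unique (tendsto_weylIntegral_exp_mul hfi hbound hσ hσ' x) ?_
    have hlim := (tendsto_integral_laplaceLine_cpow_neg hσ.le hφ.aestronglyMeasurable hφσ
      x).const_mul (Complex.Gamma σ)
    simp only [← integral_const_mul, ← mul_assoc] at hlim
    refine hlim.congr' ?_
    filter_upwards [self_mem_nhdsWithin] with μ (hμ : 0 < μ)
    simpa using (((hf.exp_mul μ).weylIntegral_of_pos hμ hσ).eq_integral x).symm

theorem weylIntegral_exp_mul (hf : HasSymbol 0 φ 1 f) (hfi : Integrable f) (hlam : 0 ≤ lam)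
    (hσ : 0 < σ) (hσ' : σ ≤ 1) (hφσ : Integrable fun ω ↦ ‖laplaceLine 0 ω‖ ^ (-σ) * ‖φ ω‖) :
    HasSymbol lam φ (fun z ↦ Complex.Gamma σ * z ^ (-(σ : ℂ)))
      (weylIntegral σ fun x ↦ cexp (lam * x) * f x) := by
  rcases hlam.eq_or_lt with rfl | hlam
  · simpa using hf.weylIntegral_zero hfi hσ hσ' hφσ
  · simpa using (hf.exp_mul lam).weylIntegral_of_pos hlam hσ

end HasSymbol

section FourierDecay

theorem norm_fourier_le_integral_norm {E : Type*} [NormedAddCommGroup E] [NormedSpace ℂ E]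
    (f : ℝ → E) (ω : ℝ) : ‖𝓕 f ω‖ ≤ ∫ x, ‖f x‖ :=
  VectorFourier.norm_fourierIntegral_le_integral_norm _ _ _ _ _

theorem exists_norm_fourier_le_one_add_abs_rpow {E : Type*} [NormedAddCommGroup E]
    [NormedSpace ℂ E] {f : ℝ → E} {N : ℕ} (hf : ContDiff ℝ N f)
    (hint : ∀ k ≤ N, Integrable (iteratedDeriv k f)) :
    ∃ C, ∀ ω, ‖𝓕 f ω‖ ≤ C * (1 + |ω|) ^ (-(N : ℝ)) := by
  refine ⟨2 ^ (N - 1) * ((∫ x, ‖f x‖) + ∫ x, ‖iteratedDeriv N f x‖), fun ω ↦ ?_⟩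
  have hderiv : |ω| ^ N * ‖𝓕 f ω‖ ≤ ∫ x, ‖iteratedDeriv N f x‖ := by
    have hfourier := congrFun (Real.fourier_iteratedDeriv (N := N) (mod_cast hf)
      (fun k hk ↦ hint k (mod_cast hk)) le_rfl) ω
    refine le_trans ?_ (norm_fourier_le_integral_norm (iteratedDeriv N f) ω)
    rw [hfourier, norm_smul, norm_pow]
    gcongr
    simpa [laplaceLine, mul_comm, mul_left_comm] using abs_le_norm_laplaceLine 0 ω
  rw [Real.rpow_neg (by positivity), Real.rpow_natCast, ← div_eq_mul_inv,
    le_div_iff₀ (by positivity)]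
  calc ‖𝓕 f ω‖ * (1 + |ω|) ^ N
    _ ≤ ‖𝓕 f ω‖ * (2 ^ (N - 1) * (1 ^ N + |ω| ^ N)) := by
      gcongr
      exact add_pow_le zero_le_one (abs_nonneg ω) N
    _ = 2 ^ (N - 1) * (‖𝓕 f ω‖ + |ω| ^ N * ‖𝓕 f ω‖) := by ring
    _ ≤ _ := by
      gcongr
      exact norm_fourier_le_integral_norm f ω

theorem integrableOn_abs_rpow_Icc {s : ℝ} (hs : -1 < s) :
    IntegrableOn (fun ω : ℝ ↦ |ω| ^ s) (Icc (-1) 1) := by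
  have hright : IntervalIntegrable (fun ω : ℝ ↦ |ω| ^ s) volume 0 1 := by
    refine (intervalIntegral.intervalIntegrable_rpow' hs).congr fun ω hω ↦ ?_
    rw [uIoc_of_le zero_le_one] at hω
    simp only [abs_of_pos hω.1]
  have hleft : IntervalIntegrable (fun ω : ℝ ↦ |ω| ^ s) volume 0 (-1) := by
    rw [IntervalIntegrable.iff_comp_neg]
    simpa using hright
  exact (intervalIntegrable_iff_integrableOn_Icc_of_le (by norm_num)).1 (hleft.symm.trans hright)

theorem integrable_one_add_abs_rpow_neg {r : ℝ} (hr : 1 < r) :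
    Integrable fun ω : ℝ ↦ (1 + |ω|) ^ (-r) := by
  simpa using integrable_one_add_norm (E := ℝ) (μ := volume) (r := r) (by simpa using hr)

variable {φ : ℝ → ℂ} {C lam r s : ℝ}

theorem integrable_norm_laplaceLine_rpow_mul_of_nonpos (hφ : AEStronglyMeasurable φ)
    (hC : ∀ ω, ‖φ ω‖ ≤ C * (1 + |ω|) ^ (-r)) (hs : -1 < s) (hs' : s ≤ 0) (hr : 1 < r) :
    Integrable fun ω ↦ ‖laplaceLine lam ω‖ ^ s * ‖φ ω‖ := by
  have hline : Measurable (laplaceLine lam) :=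
    (by fun_prop : Continuous (laplaceLine lam)).measurable
  have hmeas : AEStronglyMeasurable fun ω ↦ ‖laplaceLine lam ω‖ ^ s * ‖φ ω‖ :=
    (Measurable.aestronglyMeasurable (by fun_prop)).mul hφ.norm
  have hC₀ : 0 ≤ C := by simpa using (norm_nonneg _).trans (hC 0)
  have hle {ω : ℝ} (hω : ω ≠ 0) : ‖laplaceLine lam ω‖ ^ s ≤ |ω| ^ s :=
    Real.rpow_le_rpow_of_nonpos (abs_pos.2 hω) (abs_le_norm_laplaceLine lam ω) hs'
  rw [← integrableOn_univ, ← union_compl_self (Icc (-1 : ℝ) 1)]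
  refine IntegrableOn.union ?_ ?_
  · refine ((integrableOn_abs_rpow_Icc hs).mul_const C).mono' hmeas.restrict (ae_restrict_of_ae ?_)
    filter_upwards [volume.ae_ne 0] with ω hω
    rw [Real.norm_of_nonneg (by positivity)]
    refine mul_le_mul (hle hω) ((hC ω).trans (mul_le_of_le_one_right hC₀ ?_)) (norm_nonneg _)
      (by positivity)
    exact Real.rpow_le_one_of_one_le_of_nonpos (by linarith [abs_nonneg ω]) (by linarith)
  · refine ((integrable_one_add_abs_rpow_neg hr).const_mul C).integrableOn.mono' hmeas.restrict ?_
    filter_upwards [ae_restrict_mem measurableSet_Icc.compl] with ω hω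
    have hω' : 1 < |ω| := lt_of_not_ge fun h ↦ hω (abs_le.1 h)
    rw [Real.norm_of_nonneg (by positivity)]
    refine (mul_le_of_le_one_left (norm_nonneg _) ?_).trans (hC ω)
    exact (hle (abs_pos.1 (zero_lt_one.trans hω'))).trans
      (Real.rpow_le_one_of_one_le_of_nonpos hω'.le hs')

theorem integrable_norm_laplaceLine_rpow_mul_of_nonneg (hφ : AEStronglyMeasurable φ)
    (hC : ∀ ω, ‖φ ω‖ ≤ C * (1 + |ω|) ^ (-r)) (hs : 0 ≤ s) (hr : s + 1 < r) :
    Integrable fun ω ↦ ‖laplaceLine lam ω‖ ^ s * ‖φ ω‖ := by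
  have hline : Continuous fun ω ↦ ‖laplaceLine lam ω‖ ^ s :=
    Continuous.rpow_const (by fun_prop) fun ω ↦ Or.inr hs
  refine ((integrable_one_add_abs_rpow_neg (r := r - s) (by linarith)).const_mul
    ((|lam| + 2 * π) ^ s * C)).mono' (hline.aestronglyMeasurable.mul hφ.norm)
    (.of_forall fun ω ↦ ?_)
  have hpos : 0 < 1 + |ω| := by positivity
  rw [Real.norm_of_nonneg (by positivity)]
  calc ‖laplaceLine lam ω‖ ^ s * ‖φ ω‖
    _ ≤ ((|lam| + 2 * π) * (1 + |ω|)) ^ s * (C * (1 + |ω|) ^ (-r)) := by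
      gcongr
      · exact norm_laplaceLine_le lam ω
      · exact hC ω
    _ = _ := by
      rw [Real.mul_rpow (by positivity) hpos.le, neg_sub, sub_eq_add_neg, Real.rpow_add hpos]
      ring

theorem integrable_norm_laplaceLine_rpow_mul (hφ : AEStronglyMeasurable φ)
    (hC : ∀ ω, ‖φ ω‖ ≤ C * (1 + |ω|) ^ (-r)) (hs : -1 < s) (hr : 1 < r) (hsr : s + 1 < r) :
    Integrable fun ω ↦ ‖laplaceLine lam ω‖ ^ s * ‖φ ω‖ :=
  (le_total s 0).elim
    (fun hs' ↦ integrable_norm_laplaceLine_rpow_mul_of_nonpos hφ hC hs hs' hr)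
    fun hs' ↦ integrable_norm_laplaceLine_rpow_mul_of_nonneg hφ hC hs' hsr

end FourierDecay

theorem hasSymbol_fourier {f : ℝ → ℂ} (hf : Continuous f) (hfi : Integrable f)
    (hFf : Integrable (𝓕 f)) : HasSymbol 0 (𝓕 f) 1 f where
  integrable := by simpa using hFf
  eq_integral x := by
    rw [← congrFun (hf.fourierInv_fourier_eq hfi hFf) x, Real.fourierInv_eq']
    refine integral_congr_ae (.of_forall fun ω ↦ ?_)
    simp [laplaceLine, mul_comm, mul_left_comm, mul_assoc]

section FractionalDerivative

theorem iteratedDeriv_ofReal_comp {u : ℝ → ℝ} {n : ℕ} (hu : ContDiff ℝ n u) {k : ℕ}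
    (hk : k ≤ n) :
    iteratedDeriv k (fun x ↦ (u x : ℂ)) = fun x ↦ ((iteratedDeriv k u x : ℝ) : ℂ) := by
  induction k with
  | zero => simp only [iteratedDeriv_zero]
  | succ k ih =>
    have hdiff := hu.differentiable_iteratedDeriv k (by exact_mod_cast hk)
    rw [iteratedDeriv_succ, ih (Nat.le_of_succ_le hk), iteratedDeriv_succ]
    exact funext fun x ↦ (hdiff x).hasDerivAt.ofReal_comp.deriv

theorem differentiableAt_and_ofReal_deriv_eq {f : ℝ → ℝ} {f' : ℂ} {x : ℝ}
    (h : HasDerivAt (fun y ↦ (f y : ℂ)) f' x) :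
    DifferentiableAt ℝ f x ∧ ((deriv f x : ℝ) : ℂ) = f' := by
  have hre : HasDerivAt f f'.re x := reCLM.hasFDerivAt.comp_hasDerivAt x h
  exact ⟨hre.differentiableAt, hre.deriv ▸ hre.ofReal_comp.unique h⟩

/-- `f` is integrable, is the inverse Fourier integral of `𝓕 f`, and `𝓕 f ω = O((1 + |ω|)⁻ʳ)`. All
that the argument needs to know about the regularity of `u` is contained in this notion. -/
structure HasFourierDecay (f : ℝ → ℂ) (r : ℝ) : Prop where
  integrable : Integrable f
  hasSymbol : HasSymbol 0 (𝓕 f) 1 f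
  exists_norm_fourier_le : ∃ C, ∀ ω, ‖𝓕 f ω‖ ≤ C * (1 + |ω|) ^ (-r)

theorem continuous_fourier {f : ℝ → ℂ} (hf : Integrable f) : Continuous (𝓕 f) :=
  VectorFourier.fourierIntegral_continuous Real.continuous_fourierChar (by exact continuous_inner)
    hf

theorem hasFourierDecay_of_contDiff {u : ℝ → ℝ} {N : ℕ} (hN : 1 < N) (hu : ContDiff ℝ N u)
    (hint : ∀ k ≤ N, Integrable (iteratedDeriv k u)) : HasFourierDecay (fun x ↦ (u x : ℂ)) N := by
  have hui : Integrable fun x ↦ (u x : ℂ) := (iteratedDeriv_zero (f := u) ▸ hint 0 N.zero_le).ofReal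
  have hdecay := exists_norm_fourier_le_one_add_abs_rpow (ofRealCLM.contDiff.comp hu)
    fun k hk ↦ by
      simp only [Function.comp_def, ofRealCLM_apply, iteratedDeriv_ofReal_comp hu hk]
      exact (hint k hk).ofReal
  have hN' : (1 : ℝ) < N := by exact_mod_cast hN
  refine ⟨hui, hasSymbol_fourier (continuous_ofReal.comp hu.continuous) hui ?_, hdecay⟩
  obtain ⟨C, hC⟩ := hdecay
  exact ((integrable_one_add_abs_rpow_neg hN').const_mul C).mono'
    (continuous_fourier hui).aestronglyMeasurable (.of_forall hC)

namespace HasFourierDecay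

variable {f : ℝ → ℂ} {r s : ℝ}

theorem integrable_norm_rpow_mul (hf : HasFourierDecay f r) (hs : -1 < s) (hr : 1 < r)
    (hsr : s + 1 < r) (lam : ℝ) :
    Integrable fun ω ↦ ‖laplaceLine lam ω‖ ^ s * ‖𝓕 f ω‖ := by
  obtain ⟨C, hC⟩ := hf.exists_norm_fourier_le
  exact integrable_norm_laplaceLine_rpow_mul
    (continuous_fourier hf.integrable).aestronglyMeasurable hC hs hr hsr

theorem integrable_cpow_mul (hf : HasFourierDecay f r) (hs : -1 < s) (hr : 1 < r)
    (hsr : s + 1 < r) (lam : ℝ) :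
    Integrable fun ω ↦ laplaceLine lam ω ^ (s : ℂ) * 𝓕 f ω := by
  have hmeas : Measurable (laplaceLine lam) := Continuous.measurable (by fun_prop)
  refine (hf.integrable_norm_rpow_mul hs hr hsr lam).mono' ?_ (.of_forall fun ω ↦ ?_)
  · exact (hmeas.pow_const _).aestronglyMeasurable.mul
      (continuous_fourier hf.integrable).aestronglyMeasurable
  · rw [norm_mul, norm_cpow_real]

end HasFourierDecay

theorem HasSymbol.differentiable_and_ofReal_deriv {lam : ℝ} {φ : ℝ → ℂ} {m : ℂ → ℂ} {R : ℝ → ℝ}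
    (hR : HasSymbol lam φ m fun x ↦ (R x : ℂ))
    (hint : Integrable fun ω ↦ laplaceLine lam ω * m (laplaceLine lam ω) * φ ω) :
    Differentiable ℝ R ∧ HasSymbol lam φ (fun z ↦ z * m z) fun x ↦ ((deriv R x : ℝ) : ℂ) := by
  have hderiv := fun x ↦ differentiableAt_and_ofReal_deriv_eq (hR.hasDerivAt ⟨hint, fun _ ↦ rfl⟩ x)
  exact ⟨fun x ↦ (hderiv x).1, hint, fun x ↦ (hderiv x).2⟩

theorem HasSymbol.ofReal_iteratedDeriv {lam : ℝ} {φ : ℝ → ℂ} {m : ℂ → ℂ} {R : ℝ → ℝ} {n : ℕ}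
    (hR : HasSymbol lam φ m fun x ↦ (R x : ℂ))
    (hint : ∀ k ≤ n, Integrable fun ω ↦ laplaceLine lam ω ^ k * m (laplaceLine lam ω) * φ ω)
    {k : ℕ} (hk : k ≤ n) :
    HasSymbol lam φ (fun z ↦ z ^ k * m z) fun x ↦ ((iteratedDeriv k R x : ℝ) : ℂ) := by
  induction k with
  | zero => simpa only [pow_zero, one_mul, iteratedDeriv_zero] using hR
  | succ k ih =>
    simpa only [iteratedDeriv_succ, pow_succ', mul_assoc] using
      ((ih (Nat.le_of_succ_le hk)).differentiable_and_ofReal_deriv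
        (by simpa only [pow_succ', mul_assoc] using hint (k + 1) hk)).2

theorem HasSymbol.differentiable_iteratedDeriv {lam : ℝ} {φ : ℝ → ℂ} {m : ℂ → ℂ} {R : ℝ → ℝ}
    {n : ℕ} (hR : HasSymbol lam φ m fun x ↦ (R x : ℂ))
    (hint : ∀ k ≤ n, Integrable fun ω ↦ laplaceLine lam ω ^ k * m (laplaceLine lam ω) * φ ω)
    {k : ℕ} (hk : k < n) : Differentiable ℝ (iteratedDeriv k R) :=
  ((hR.ofReal_iteratedDeriv hint hk.le).differentiable_and_ofReal_deriv
    (by simpa only [pow_succ', mul_assoc] using hint (k + 1) hk)).1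

theorem rlOrder_sub_pos (α : ℝ) : 0 < (rlOrder α : ℝ) - α := by
  rw [rlOrder, Nat.cast_add_one]
  exact sub_pos.2 (Nat.lt_floor_add_one α)

theorem rlOrder_sub_lt_one {α : ℝ} (hα : 0 < α) (hαn : ∀ k : ℕ, (k : ℝ) ≠ α) :
    (rlOrder α : ℝ) - α < 1 := by
  rw [rlOrder, Nat.cast_add_one]
  linarith [(Nat.floor_le hα.le).lt_of_ne (hαn _)]

theorem preimage_const_sub_Iic_self (x : ℝ) : (fun t ↦ x - t) ⁻¹' Iic x = Ici 0 := by
  rw [preimage_const_sub_Iic, sub_self]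

theorem rlIntegral_eq_weylIntegral (α : ℝ) (f : ℝ → ℝ) (x : ℝ) :
    rlIntegral α f x = weylIntegral (rlOrder α - α) f x := by
  rw [rlIntegral, ← (Measure.measurePreserving_sub_left volume x).setIntegral_preimage_emb
    (MeasurableEquiv.subLeft x).measurableEmbedding, preimage_const_sub_Iic_self,
    integral_Ici_eq_integral_Ioi]
  simp only [rlIntegrand, sub_sub_cancel, weylIntegral, smul_eq_mul]

theorem integrableOn_rlIntegrand_iff {α : ℝ} {f : ℝ → ℝ} {x : ℝ} :
    IntegrableOn (rlIntegrand α f x) (Iic x) ↔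
      IntegrableOn (fun t ↦ t ^ ((rlOrder α : ℝ) - α - 1) • f (x - t)) (Ioi 0) := by
  rw [← (Measure.measurePreserving_sub_left volume x).integrableOn_comp_preimage
    (MeasurableEquiv.subLeft x).measurableEmbedding, preimage_const_sub_Iic_self,
    integrableOn_Ici_iff_integrableOn_Ioi]
  simp only [Function.comp_def, rlIntegrand, sub_sub_cancel, smul_eq_mul]

theorem integrableOn_rlIntegrand_expMul {α lam M : ℝ} {u : ℝ → ℝ} (hα : 0 < α)
    (hαn : ∀ k : ℕ, (k : ℝ) ≠ α) (hlam : 0 ≤ lam) (hu : Integrable u) (hM : ∀ x, ‖u x‖ ≤ M)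
    (x : ℝ) : IntegrableOn (rlIntegrand α (expMul lam u) x) (Iic x) := by
  have hkernel := integrableOn_rpow_smul_comp_sub_left hu hM (rlOrder_sub_pos α)
    (rlOrder_sub_lt_one hα hαn).le x
  have hexp : Integrable (fun t ↦ Real.exp (lam * (x - t)) *
      (t ^ ((rlOrder α : ℝ) - α - 1) • u (x - t))) (volume.restrict (Ioi 0)) := by
    refine hkernel.bdd_mul (c := Real.exp (lam * x)) (Continuous.aestronglyMeasurable (by fun_prop))
      ((ae_restrict_iff' measurableSet_Ioi).2 (.of_forall fun t (ht : 0 < t) ↦ ?_))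
    rw [Real.norm_of_nonneg (Real.exp_pos _).le]
    exact Real.exp_le_exp.2 (by gcongr; linarith)
  refine integrableOn_rlIntegrand_iff.2 (hexp.congr (.of_forall fun t ↦ ?_))
  simp only [expMul, smul_eq_mul]
  ring

section LeftRL

variable {α lam r : ℝ} {u : ℝ → ℝ}

theorem hasSymbol_expMul (hu : HasFourierDecay (fun x ↦ (u x : ℂ)) r) (lam : ℝ) :
    HasSymbol lam (𝓕 fun x ↦ (u x : ℂ)) 1 fun x ↦ (expMul lam u x : ℂ) := by
  simpa only [expMul, ofReal_mul, ofReal_exp] using hu.hasSymbol.exp_mul lam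

theorem hasSymbol_rlIntegral (hα : 0 < α) (hαn : ∀ k : ℕ, (k : ℝ) ≠ α) (hlam : 0 ≤ lam)
    (hr : 1 < r) (hu : HasFourierDecay (fun x ↦ (u x : ℂ)) r) :
    HasSymbol lam (𝓕 fun x ↦ (u x : ℂ))
      (fun z ↦ Complex.Gamma ((rlOrder α - α : ℝ) : ℂ) * z ^ (-((rlOrder α - α : ℝ) : ℂ)))
      fun x ↦ (rlIntegral α (expMul lam u) x : ℂ) := by
  have hpos := rlOrder_sub_pos α
  have hlt := rlOrder_sub_lt_one hα hαn
  simpa only [rlIntegral_eq_weylIntegral, ofReal_weylIntegral, expMul, ofReal_mul, ofReal_exp] using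
    hu.hasSymbol.weylIntegral_exp_mul hu.integrable hlam hpos hlt.le
      (hu.integrable_norm_rpow_mul (by linarith) hr (by linarith) 0)

theorem integrable_pow_mul_rlIntegral_symbol (hα : 0 < α) (hαn : ∀ k : ℕ, (k : ℝ) ≠ α)
    (hr : α + 1 < r) (hu : HasFourierDecay (fun x ↦ (u x : ℂ)) r) {k : ℕ} (hk : k ≤ rlOrder α) :
    Integrable fun ω ↦ laplaceLine lam ω ^ k *
      (Complex.Gamma ((rlOrder α - α : ℝ) : ℂ) *
        laplaceLine lam ω ^ (-((rlOrder α - α : ℝ) : ℂ))) * 𝓕 (fun x ↦ (u x : ℂ)) ω := by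
  have hlt := rlOrder_sub_lt_one hα hαn
  have hk' : (k : ℝ) ≤ rlOrder α := by exact_mod_cast hk
  have hint := (hu.integrable_cpow_mul (s := k - (rlOrder α - α)) (lam := lam)
    (by linarith [k.cast_nonneg (α := ℝ)]) (by linarith) (by linarith)).const_mul
      (Complex.Gamma ((rlOrder α - α : ℝ) : ℂ))
  refine hint.congr ?_
  filter_upwards [volume.ae_ne 0] with ω hω
  rw [ofReal_sub (k : ℝ), cpow_sub _ _ (laplaceLine_ne_zero lam hω), cpow_neg, ofReal_natCast,
    cpow_natCast]
  ring

theorem leftRLExists_expMul (hα : 0 < α) (hαn : ∀ k : ℕ, (k : ℝ) ≠ α) (hlam : 0 ≤ lam)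
    (hr : α + 1 < r) (hu : HasFourierDecay (fun x ↦ (u x : ℂ)) r) :
    LeftRLExists α (expMul lam u) := by
  refine ⟨fun x ↦ ?_, fun k hk ↦ ?_⟩
  · refine integrableOn_rlIntegrand_expMul hα hαn hlam (by simpa using hu.integrable.re)
      (M := ∫ ω, ‖𝓕 (fun x ↦ (u x : ℂ)) ω‖) (fun y ↦ ?_) x
    have hint := hu.hasSymbol.integrable.norm
    simp only [Pi.one_apply, one_mul] at hint
    simpa using hu.hasSymbol.norm_le hint (fun ω ↦ by simp) y
  · exact (hasSymbol_rlIntegral hα hαn hlam (by linarith) hu).differentiable_iteratedDeriv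
      (fun k hk ↦ integrable_pow_mul_rlIntegral_symbol hα hαn hr hu hk) hk

theorem expMul_leftTemperedRL (α lam : ℝ) (u : ℝ → ℝ) (x : ℝ) :
    expMul lam (leftTemperedRL α lam u) x = leftRL α (expMul lam u) x := by
  rw [expMul, leftTemperedRL, ← mul_assoc, ← Real.exp_add, neg_mul, add_neg_cancel, Real.exp_zero,
    one_mul]

theorem hasSymbol_expMul_leftTemperedRL (hα : 0 < α) (hαn : ∀ k : ℕ, (k : ℝ) ≠ α) (hlam : 0 ≤ lam)
    (hr : α + 1 < r) (hu : HasFourierDecay (fun x ↦ (u x : ℂ)) r) :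
    HasSymbol lam (𝓕 fun x ↦ (u x : ℂ)) (fun z ↦ z ^ (α : ℂ))
      fun x ↦ (expMul lam (leftTemperedRL α lam u) x : ℂ) := by
  have hGamma : (Real.Gamma (rlOrder α - α) : ℂ) ≠ 0 := by
    exact_mod_cast (Real.Gamma_pos_of_pos (rlOrder_sub_pos α)).ne'
  have hderiv := (((hasSymbol_rlIntegral hα hαn hlam (by linarith) hu).ofReal_iteratedDeriv
    (fun k hk ↦ integrable_pow_mul_rlIntegral_symbol hα hαn hr hu hk) le_rfl).const_mul
      (1 / Real.Gamma (rlOrder α - α) : ℂ))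
  simp only [expMul_leftTemperedRL, leftRL]
  push_cast
  refine hderiv.congr fun z _ hz ↦ ?_
  rw [Complex.Gamma_ofReal, ofReal_sub, neg_sub, ofReal_natCast, cpow_sub _ _ hz, cpow_natCast]
  field_simp

end LeftRL

end FractionalDerivative

section BinomialSeries

theorem succ_mul_ringChoose_succ {R : Type*} [NonAssocRing R] [Pow R ℕ] [NatPowAssoc R]
    [BinomialRing R] (a : R) (k : ℕ) :
    (k + 1 : ℕ) * Ring.choose a (k + 1) = Ring.choose a k * (a - k) := by
  have h := Ring.choose_smul_choose a k.le_succ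
  rwa [Nat.choose_succ_self_right, Nat.succ_sub k.le_refl, Nat.sub_self, Ring.choose_one_right,
    nsmul_eq_mul] at h

theorem mul_abs_ringChoose_eq_sub {a : ℝ} {k : ℕ} (hk : a ≤ k) :
    a * |Ring.choose a k| = k * |Ring.choose a k| - (k + 1 : ℕ) * |Ring.choose a (k + 1)| := by
  rw [← Nat.abs_cast (k + 1), ← abs_mul, succ_mul_ringChoose_succ, abs_mul,
    abs_of_nonpos (sub_nonpos.2 hk)]
  ring

theorem summable_abs_ringChoose {a : ℝ} (ha : 0 < a) : Summable fun k ↦ |Ring.choose a k| := by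
  obtain ⟨K, hK⟩ := exists_nat_ge a
  let g (i : ℕ) : ℝ := (i + K : ℕ) * |Ring.choose a (i + K)|
  have htelescope (n : ℕ) :
      a * ∑ i ∈ Finset.range n, |Ring.choose a (i + K)| = g 0 - g n := by
    rw [Finset.mul_sum, ← Finset.sum_range_sub']
    refine Finset.sum_congr rfl fun i _ ↦ ?_
    rw [mul_abs_ringChoose_eq_sub (by push_cast; linarith [i.cast_nonneg (α := ℝ)])]
    simp only [g, Nat.add_right_comm i 1 K]
  rw [← summable_nat_add_iff K]
  refine summable_of_sum_range_le (c := g 0 / a) (fun i ↦ abs_nonneg _) fun n ↦ ?_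
  rw [le_div_iff₀' ha, htelescope]
  exact sub_le_self _ (by positivity)

variable {a : ℝ} {w : ℂ}

theorem norm_ringChoose_mul_pow_le (a : ℝ) (hw : ‖w‖ ≤ 1) (k : ℕ) :
    ‖((Ring.choose a k : ℝ) : ℂ) * w ^ k‖ ≤ |Ring.choose a k| := by
  rw [norm_mul, norm_pow, norm_real, Real.norm_eq_abs]
  exact mul_le_of_le_one_right (abs_nonneg _) (pow_le_one₀ (norm_nonneg _) hw)

theorem tsum_ringChoose_mul_pow_of_norm_lt_one (a : ℝ) (hw : ‖w‖ < 1) :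
    ∑' k, ((Ring.choose a k : ℝ) : ℂ) * w ^ k = (1 + w) ^ (a : ℂ) := by
  have h := (Complex.one_add_cpow_hasFPowerSeriesOnBall_zero (a := (a : ℂ))).hasSum (y := w) (by
    rwa [← ENNReal.ofReal_one, Metric.eball_ofReal, mem_ball_zero_iff])
  simpa only [binomialSeries_apply, List.ofFn_const, List.prod_replicate, smul_eq_mul, zero_add,
    ← ofReal_choose] using h.tsum_eq

theorem continuousOn_one_add_cpow (ha : 0 < a) :
    ContinuousOn (fun w : ℂ ↦ (1 + w) ^ (a : ℂ)) (Metric.closedBall 0 1) := by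
  refine fun w hw ↦ ContinuousAt.continuousWithinAt ?_
  have hre : 0 ≤ (1 + w).re := by
    have := neg_le_of_abs_le ((abs_re_le_norm w).trans (mem_closedBall_zero_iff.1 hw))
    simpa using by linarith
  exact ContinuousAt.comp (f := fun w : ℂ ↦ 1 + w) (continuousAt_cpow_const_of_re_pos (.inl hre) ha)
    (by fun_prop)

theorem hasSum_ringChoose_mul_pow (ha : 0 < a) (hw : ‖w‖ ≤ 1) :
    HasSum (fun k ↦ ((Ring.choose a k : ℝ) : ℂ) * w ^ k) ((1 + w) ^ (a : ℂ)) := by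
  have hcont : ContinuousOn (fun w : ℂ ↦ ∑' k, ((Ring.choose a k : ℝ) : ℂ) * w ^ k)
      (Metric.closedBall 0 1) :=
    continuousOn_tsum (fun k ↦ by fun_prop) (summable_abs_ringChoose ha)
      fun k w hw ↦ norm_ringChoose_mul_pow_le a (mem_closedBall_zero_iff.1 hw) k
  have heq : EqOn (fun w : ℂ ↦ ∑' k, ((Ring.choose a k : ℝ) : ℂ) * w ^ k)
      (fun w ↦ (1 + w) ^ (a : ℂ)) (Metric.closedBall 0 1) :=
    EqOn.of_subset_closure (s := Metric.ball 0 1)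
      (fun w hw ↦ tsum_ringChoose_mul_pow_of_norm_lt_one a (mem_ball_zero_iff.1 hw)) hcont
      (continuousOn_one_add_cpow ha) Metric.ball_subset_closedBall
      (closure_ball (0 : ℂ) one_ne_zero).ge
  rw [← show _ = (1 + w) ^ (a : ℂ) from heq (mem_closedBall_zero_iff.2 hw)]
  exact ((summable_abs_ringChoose ha).of_norm_bounded (norm_ringChoose_mul_pow_le a hw)).hasSum

end BinomialSeries

section Grunwald

variable {α lam h r : ℝ} {u : ℝ → ℝ}

theorem grunwaldWeight_zero (hα : ∀ k : ℕ, (k : ℝ) ≠ α) : grunwaldWeight α 0 = 1 := by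
  have hGamma : Real.Gamma (-α) ≠ 0 := Real.Gamma_ne_zero fun m hm ↦ hα m (neg_injective hm).symm
  simp [grunwaldWeight, hGamma]

theorem succ_mul_grunwaldWeight_succ (hα : ∀ k : ℕ, (k : ℝ) ≠ α) (k : ℕ) :
    (k + 1 : ℕ) * grunwaldWeight α (k + 1) = (k - α) * grunwaldWeight α k := by
  have hk : (k : ℝ) + 1 ≠ 0 := by positivity
  have hnum : Real.Gamma ((k + 1 : ℕ) - α) = (k - α) * Real.Gamma (k - α) := by
    rw [← Real.Gamma_add_one (sub_ne_zero.2 (hα k)), Nat.cast_add_one, sub_add_eq_add_sub]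
  rw [grunwaldWeight, grunwaldWeight, hnum, Nat.cast_add_one, Real.Gamma_add_one hk,
    mul_left_comm (Real.Gamma (-α)), ← mul_div_assoc, mul_div_mul_left _ _ hk, mul_div_assoc]

theorem grunwaldWeight_eq_neg_one_pow_mul_ringChoose (hα : ∀ k : ℕ, (k : ℝ) ≠ α) (k : ℕ) :
    grunwaldWeight α k = (-1) ^ k * Ring.choose α k := by
  induction k with
  | zero => rw [grunwaldWeight_zero hα, pow_zero, Ring.choose_zero_right, mul_one]
  | succ k ih =>
    refine mul_left_cancel₀ (Nat.cast_ne_zero.2 k.succ_ne_zero) ?_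
    rw [succ_mul_grunwaldWeight_succ hα, ih, mul_left_comm (k.succ : ℝ), succ_mul_ringChoose_succ]
    ring

theorem summable_norm_grunwaldWeight (hα : 0 < α) (hαn : ∀ k : ℕ, (k : ℝ) ≠ α) :
    Summable fun k ↦ ‖(grunwaldWeight α k : ℂ)‖ := by
  simpa only [norm_real, Real.norm_eq_abs, grunwaldWeight_eq_neg_one_pow_mul_ringChoose hαn,
    abs_mul, abs_pow, abs_neg, abs_one, one_pow, one_mul] using summable_abs_ringChoose hα

theorem hasSum_grunwaldWeight_mul_pow (hα : 0 < α) (hαn : ∀ k : ℕ, (k : ℝ) ≠ α) {w : ℂ}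
    (hw : ‖w‖ ≤ 1) :
    HasSum (fun k ↦ (grunwaldWeight α k : ℂ) * w ^ k) ((1 - w) ^ (α : ℂ)) := by
  rw [sub_eq_add_neg]
  refine (hasSum_ringChoose_mul_pow hα ((norm_neg w).trans_le hw)).congr_fun fun k ↦ ?_
  rw [grunwaldWeight_eq_neg_one_pow_mul_ringChoose hαn, neg_pow w]
  push_cast
  ring

theorem hasSum_grunwaldWeight_mul_cexp (hα : 0 < α) (hαn : ∀ k : ℕ, (k : ℝ) ≠ α)
    (hlam : 0 ≤ lam) (hh : 0 < h) {z : ℂ} (hz : z.re = lam) :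
    HasSum (fun k : ℕ ↦ (grunwaldWeight α k : ℂ) * cexp (-(z * (k * h : ℝ))))
      ((1 - cexp (-(h * z))) ^ (α : ℂ)) := by
  have hnorm : ‖cexp (-(h * z))‖ ≤ 1 := by
    rw [norm_exp, neg_re, re_ofReal_mul, hz, Real.exp_le_one_iff]
    exact neg_nonpos.2 (mul_nonneg hh.le hlam)
  refine (hasSum_grunwaldWeight_mul_pow hα hαn hnorm).congr_fun fun k ↦ ?_
  rw [← Complex.exp_nat_mul]
  congr 2
  push_cast
  ring

theorem exp_mul_grunwaldTerm (α lam h : ℝ) (p : ℤ) (u : ℝ → ℝ) (x : ℝ) (k : ℕ) :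
    Real.exp (lam * x) * grunwaldTerm α lam h p u x k =
      grunwaldWeight α k * expMul lam u (x - k * h + p * h) := by
  have hshift : x - k * h + p * h = x - (k - p) * h := by ring
  have hexp : Real.exp (lam * (x - (k - p) * h)) =
      Real.exp (lam * x) * Real.exp (-((k : ℝ) - p) * lam * h) := by
    rw [← Real.exp_add]
    ring_nf
  rw [grunwaldTerm, expMul, hshift, hexp]
  ring

theorem summable_grunwaldTerm (hα : 0 < α) (hαn : ∀ k : ℕ, (k : ℝ) ≠ α) (hlam : 0 ≤ lam)
    (hh : 0 < h) (hu : HasFourierDecay (fun x ↦ (u x : ℂ)) r) (p : ℤ) (x : ℝ) :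
    Summable (grunwaldTerm α lam h p u x) := by
  have hsum := (((hasSymbol_expMul hu lam).translate (p * h)).hasSum_translate hlam
    (fun k : ℕ ↦ by positivity) (summable_norm_grunwaldWeight hα hαn)
    (fun z hz ↦ hasSum_grunwaldWeight_mul_cexp hα hαn hlam hh hz) x).summable
  rw [← summable_mul_left_iff (Real.exp_ne_zero (lam * x))]
  simp only [exp_mul_grunwaldTerm]
  exact_mod_cast hsum

theorem hasSymbol_expMul_temperedGrunwald (hα : 0 < α) (hαn : ∀ k : ℕ, (k : ℝ) ≠ α)
    (hlam : 0 ≤ lam) (hh : 0 < h) (hu : HasFourierDecay (fun x ↦ (u x : ℂ)) r) (p : ℤ) :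
    HasSymbol lam (𝓕 fun x ↦ (u x : ℂ))
      (fun z ↦ ((h ^ α : ℝ) : ℂ)⁻¹ * ((1 - cexp (-(h * z))) ^ (α : ℂ) * cexp (p * (h * z))))
      fun x ↦ (expMul lam (temperedGrunwald α lam h p u) x : ℂ) := by
  have hsum := (((hasSymbol_expMul hu lam).translate (p * h)).tsum_translate hlam
    (fun k : ℕ ↦ by positivity) (summable_norm_grunwaldWeight hα hαn)
    (fun z hz ↦ hasSum_grunwaldWeight_mul_cexp hα hαn hlam hh hz)).const_mul ((h ^ α : ℝ) : ℂ)⁻¹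
  have heq (x : ℝ) : (expMul lam (temperedGrunwald α lam h p u) x : ℂ) = ((h ^ α : ℝ) : ℂ)⁻¹ *
      ∑' k : ℕ, (grunwaldWeight α k : ℂ) * (expMul lam u (x - k * h + p * h) : ℂ) := by
    rw [expMul, temperedGrunwald, one_div, mul_left_comm, ← tsum_mul_left]
    simp only [exp_mul_grunwaldTerm]
    push_cast
    rfl
  simp only [heq]
  refine hsum.congr fun z _ _ ↦ ?_
  simp only [Pi.one_apply, mul_one]
  congr 3
  push_cast
  ring

end Grunwald

section SymbolExpansion

theorem isBigO_pow_nhds_zero_one (n : ℕ) : (fun ζ : ℂ ↦ ζ ^ n) =O[𝓝 0] fun _ ↦ (1 : ℂ) :=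
  (continuous_pow n).continuousAt.isBigO_one ℂ

theorem isBigO_mul_sub_one_add_mul_sq {f g : ℂ → ℂ} {p q : ℂ}
    (hf : (fun ζ ↦ f ζ - (1 + p * ζ ^ 2)) =O[𝓝 0] fun ζ ↦ ζ ^ 4)
    (hg : (fun ζ ↦ g ζ - (1 + q * ζ ^ 2)) =O[𝓝 0] fun ζ ↦ ζ ^ 4) :
    (fun ζ ↦ f ζ * g ζ - (1 + (p + q) * ζ ^ 2)) =O[𝓝 0] fun ζ ↦ ζ ^ 4 := by
  have hpoly (c : ℂ) : (fun ζ : ℂ ↦ 1 + c * ζ ^ 2) =O[𝓝 0] fun _ ↦ (1 : ℂ) :=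
    (show Continuous fun ζ : ℂ ↦ 1 + c * ζ ^ 2 by fun_prop).continuousAt.isBigO_one ℂ
  have hg_one : g =O[𝓝 0] fun _ ↦ (1 : ℂ) := by
    simpa only [sub_add_cancel] using (hg.trans (isBigO_pow_nhds_zero_one 4)).add (hpoly q)
  have hfg := hf.mul hg_one
  have hpg := (hpoly p).mul hg
  simp only [mul_one, one_mul] at hfg hpg
  refine ((hfg.add hpg).add ((isBigO_refl _ _).const_mul_left (p * q))).congr_left fun ζ ↦ ?_
  ring

theorem cexp_mul_sub_sum_isBigO_pow (c : ℂ) (n : ℕ) :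
    (fun ζ ↦ cexp (c * ζ) - ∑ k ∈ Finset.range n, (c * ζ) ^ k / k.factorial) =O[𝓝 0]
      fun ζ ↦ ζ ^ n := by
  have hc : Tendsto (fun ζ : ℂ ↦ c * ζ) (𝓝 0) (𝓝 0) := by
    simpa only [mul_zero] using (continuous_const_mul c).tendsto 0
  refine ((Complex.exp_sub_sum_range_isBigO_pow n).comp_tendsto hc).trans ?_
  simp only [Function.comp_def, mul_pow]
  exact (isBigO_refl _ _).const_mul_left _

theorem one_add_cpow_sub_isBigO (a : ℂ) :
    (fun w ↦ (1 + w) ^ a - (1 + a * w)) =O[𝓝 0] fun w ↦ w ^ 2 := by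
  have h := (Complex.one_add_cpow_hasFPowerSeriesAt_zero (a := a)).isBigO_sub_partialSum_pow 2
  simpa [FormalMultilinearSeries.partialSum, Finset.sum_range_succ, binomialSeries,
    FormalMultilinearSeries.coeff_ofScalars, mul_comm a, ← norm_pow] using h

/-- `sinh (ζ / 2) / (ζ / 2) - 1`, the relative error of the symbol of the centered first difference
with unit step. -/
def sinhcSubOne (ζ : ℂ) : ℂ := (cexp (ζ / 2) - cexp (-(ζ / 2)) - ζ) / ζ

theorem sinhcSubOne_sub_isBigO :
    (fun ζ ↦ sinhcSubOne ζ - ζ ^ 2 / 24) =O[𝓝 0] fun ζ ↦ ζ ^ 4 := by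
  have hnum := (cexp_mul_sub_sum_isBigO_pow (1 / 2) 5).sub (cexp_mul_sub_sum_isBigO_pow (-1 / 2) 5)
  refine ((hnum.mul (isBigO_refl (fun ζ : ℂ ↦ ζ⁻¹) (𝓝 0))).congr (fun ζ ↦ ?_) fun ζ ↦ ?_)
  · rcases eq_or_ne ζ 0 with rfl | hζ
    · simp [sinhcSubOne]
    · rw [sinhcSubOne, show 1 / 2 * ζ = ζ / 2 by ring, show -1 / 2 * ζ = -(ζ / 2) by ring]
      simp only [Finset.sum_range_succ, Finset.sum_range_zero, Nat.factorial]
      field_simp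
      push_cast
      ring
  · rcases eq_or_ne ζ 0 with rfl | hζ
    · simp
    · rw [pow_succ, mul_inv_cancel_right₀ hζ]

theorem sinhcSubOne_isBigO : sinhcSubOne =O[𝓝 0] fun ζ ↦ ζ ^ 2 := by
  have hpow : (fun ζ : ℂ ↦ ζ ^ 4) =O[𝓝 0] fun ζ ↦ ζ ^ 2 := by
    exact ((isBigO_refl (fun ζ : ℂ ↦ ζ ^ 2) _).mul (isBigO_pow_nhds_zero_one 2)).congr
      (fun ζ ↦ by ring) fun ζ ↦ mul_one _
  refine ((sinhcSubOne_sub_isBigO.trans hpow).add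
    ((isBigO_refl _ _).const_mul_left (1 / 24))).congr_left fun ζ ↦ ?_
  ring

theorem tendsto_sinhcSubOne : Tendsto sinhcSubOne (𝓝 0) (𝓝 0) :=
  sinhcSubOne_isBigO.trans_tendsto (by simpa using (continuous_pow (M := ℂ) 2).tendsto 0)

theorem one_add_sinhcSubOne_cpow_sub_isBigO (a : ℂ) :
    (fun ζ ↦ (1 + sinhcSubOne ζ) ^ a - (1 + a / 24 * ζ ^ 2)) =O[𝓝 0] fun ζ ↦ ζ ^ 4 := by
  have hlinear := ((one_add_cpow_sub_isBigO a).comp_tendsto tendsto_sinhcSubOne).trans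
    (sinhcSubOne_isBigO.pow 2)
  simp only [Function.comp_def, ← pow_mul] at hlinear
  refine (hlinear.add (sinhcSubOne_sub_isBigO.const_mul_left a)).congr_left fun ζ ↦ ?_
  ring

theorem one_sub_cexp_neg_eq (ζ : ℂ) :
    1 - cexp (-ζ) = ζ * (cexp (-(ζ / 2)) * (1 + sinhcSubOne ζ)) := by
  rcases eq_or_ne ζ 0 with rfl | hζ
  · simp
  · have hsq : cexp (-ζ) = cexp (-(ζ / 2)) * cexp (-(ζ / 2)) := by
      rw [← Complex.exp_add]
      ring_nf
    have hone : cexp (-(ζ / 2)) * cexp (ζ / 2) = 1 := by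
      rw [← Complex.exp_add, neg_add_cancel, Complex.exp_zero]
    have hsinhc : ζ * (1 + sinhcSubOne ζ) = cexp (ζ / 2) - cexp (-(ζ / 2)) := by
      rw [sinhcSubOne]
      field_simp
      ring
    rw [hsq, mul_left_comm, hsinhc]
    linear_combination -hone

theorem mul_cpow_of_re_nonneg_of_re_pos {x y : ℂ} (hx : 0 ≤ x.re) (hy : 0 < y.re) (a : ℂ) :
    (x * y) ^ a = x ^ a * y ^ a := by
  have hy0 : y ≠ 0 := by
    rintro rfl
    exact hy.ne rfl
  rcases eq_or_ne x 0 with rfl | hx0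
  · rcases eq_or_ne a 0 with rfl | ha <;> simp [*]
  · have hargx := abs_le.1 (abs_arg_le_pi_div_two_iff.2 hx)
    have hargy := abs_lt.1 (abs_arg_lt_pi_div_two_iff.2 (.inl hy))
    rw [cpow_def_of_ne_zero (mul_ne_zero hx0 hy0), cpow_def_of_ne_zero hx0,
      cpow_def_of_ne_zero hy0, Complex.log_mul hx0 hy0 ⟨by linarith, by linarith⟩, add_mul,
      Complex.exp_add]

theorem cexp_cpow {z : ℂ} (hz : |z.im| < π) (a : ℂ) : cexp z ^ a = cexp (a * z) := by
  rw [cpow_def_of_ne_zero (Complex.exp_ne_zero z),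
    Complex.log_exp (abs_lt.1 hz).1 (abs_lt.1 hz).2.le, mul_comm]

theorem eventually_one_sub_cexp_neg_cpow_eq (a : ℂ) :
    ∀ᶠ ζ in 𝓝[{ζ : ℂ | 0 ≤ ζ.re}] 0, (1 - cexp (-ζ)) ^ a =
      ζ ^ a * (cexp (-(a / 2) * ζ) * (1 + sinhcSubOne ζ) ^ a) := by
  have hsinhc : Tendsto (fun ζ ↦ 1 + sinhcSubOne ζ) (𝓝 0) (𝓝 1) := by
    simpa using tendsto_const_nhds.add tendsto_sinhcSubOne
  have hexp : Tendsto (fun ζ ↦ cexp (-(ζ / 2))) (𝓝 0) (𝓝 1) := by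
    simpa using (show Continuous fun ζ ↦ cexp (-(ζ / 2)) by fun_prop).tendsto 0
  have hre {f : ℂ → ℂ} (hf : Tendsto f (𝓝 0) (𝓝 1)) : ∀ᶠ ζ in 𝓝 0, 0 < (f ζ).re :=
    ((continuous_re.tendsto 1).comp hf).eventually (lt_mem_nhds one_pos)
  have him : ∀ᶠ ζ : ℂ in 𝓝 0, |(-(ζ / 2)).im| < π :=
    (show Continuous fun ζ : ℂ ↦ |(-(ζ / 2)).im| by fun_prop).continuousAt.eventually
      (gt_mem_nhds (by simpa using Real.pi_pos))
  filter_upwards [self_mem_nhdsWithin, nhdsWithin_le_nhds (hre hsinhc),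
    nhdsWithin_le_nhds (hre hexp), nhdsWithin_le_nhds him,
    nhdsWithin_le_nhds (hre (by simpa using hexp.mul hsinhc))]
    with ζ hζ hsinhc_re hexp_re hζ_im hprod_re
  rw [one_sub_cexp_neg_eq, mul_cpow_of_re_nonneg_of_re_pos hζ hprod_re,
    mul_cpow_of_re_nonneg_of_re_pos hexp_re.le hsinhc_re, cexp_cpow hζ_im]
  ring_nf

/-- The symbol of the truncation error of the quasi-compact scheme with unit step: the first summand
is the symbol of `temperedP` applied to the derivative, the second that of the combination of the
three shifted Grünwald operators. -/
def quasiCompactSymbol (α : ℝ) (ζ : ℂ) : ℂ :=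
  (1 + coeffB α * (cexp (-ζ) - 2 + cexp ζ)) * ζ ^ (α : ℂ) -
    (coeffMuOne α * cexp ζ + coeffMuZero α + coeffMuNegOne α * cexp (-ζ)) *
      (1 - cexp (-ζ)) ^ (α : ℂ)

theorem compactFactor_sub_isBigO (b : ℂ) :
    (fun ζ ↦ 1 + b * (cexp (-ζ) - 2 + cexp ζ) - (1 + b * ζ ^ 2)) =O[𝓝 0] fun ζ ↦ ζ ^ 4 := by
  refine (((cexp_mul_sub_sum_isBigO_pow (-1) 4).add
    (cexp_mul_sub_sum_isBigO_pow 1 4)).const_mul_left b).congr_left fun ζ ↦ ?_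
  simp only [Finset.sum_range_succ, Finset.sum_range_zero, Nat.factorial, one_mul, neg_mul]
  push_cast
  ring

/-- This determines the weights up to their second moment: they sum to `1`, and their first and
third moments at the points `1 - α / 2`, `-α / 2`, `-1 - α / 2` vanish. The coefficient `coeffB`
compensates the quadratic term. -/
theorem shiftFactor_sub_isBigO (α : ℝ) :
    (fun ζ : ℂ ↦ coeffMuOne α * cexp ((1 - α / 2) * ζ) + coeffMuZero α * cexp (-(α / 2) * ζ) +
      coeffMuNegOne α * cexp ((-1 - α / 2) * ζ) - (1 + (4 - α ^ 2) / 24 * ζ ^ 2)) =O[𝓝 0]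
        fun ζ ↦ ζ ^ 4 := by
  have hexp (c : ℂ) := cexp_mul_sub_sum_isBigO_pow c 4
  refine ((((hexp (1 - α / 2)).const_mul_left (coeffMuOne α : ℂ)).add
    ((hexp (-(α / 2))).const_mul_left (coeffMuZero α : ℂ))).add
    ((hexp (-1 - α / 2)).const_mul_left (coeffMuNegOne α : ℂ))).congr_left fun ζ ↦ ?_
  simp only [Finset.sum_range_succ, Finset.sum_range_zero, Nat.factorial, coeffMuOne, coeffMuZero,
    coeffMuNegOne]
  push_cast
  ring

theorem eventually_quasiCompactSymbol_eq (α : ℝ) :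
    ∀ᶠ ζ in 𝓝[{ζ : ℂ | 0 ≤ ζ.re}] 0, quasiCompactSymbol α ζ = ζ ^ (α : ℂ) *
      (1 + coeffB α * (cexp (-ζ) - 2 + cexp ζ) -
        (coeffMuOne α * cexp ((1 - α / 2) * ζ) + coeffMuZero α * cexp (-(α / 2) * ζ) +
          coeffMuNegOne α * cexp ((-1 - α / 2) * ζ)) * (1 + sinhcSubOne ζ) ^ (α : ℂ)) := by
  filter_upwards [eventually_one_sub_cexp_neg_cpow_eq α] with ζ hζ
  have hone : cexp ((1 - α / 2) * ζ) = cexp ζ * cexp (-(α / 2) * ζ) := by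
    rw [← Complex.exp_add]
    ring_nf
  have hneg : cexp ((-1 - α / 2) * ζ) = cexp (-ζ) * cexp (-(α / 2) * ζ) := by
    rw [← Complex.exp_add]
    ring_nf
  rw [quasiCompactSymbol, hζ, hone, hneg]
  ring

theorem quasiCompactSymbol_isBigO (α : ℝ) :
    quasiCompactSymbol α =O[𝓝[{ζ : ℂ | 0 ≤ ζ.re}] 0] fun ζ ↦ ζ ^ (α : ℂ) * ζ ^ 4 := by
  have hbracket := (compactFactor_sub_isBigO (coeffB α)).sub (isBigO_mul_sub_one_add_mul_sq
    (shiftFactor_sub_isBigO α) (one_add_sinhcSubOne_cpow_sub_isBigO α))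
  refine ((isBigO_refl _ _).mul ((hbracket.mono nhdsWithin_le_nhds).congr_left fun ζ ↦ ?_)).congr'
    ((eventually_quasiCompactSymbol_eq α).mono fun ζ hζ ↦ hζ.symm) .rfl
  simp only [coeffB]
  push_cast
  ring

theorem exists_forall_mem_norm_le_mul_rpow {E F : Type*} [SeminormedAddCommGroup E]
    [SeminormedAddCommGroup F] {f : E → F} {S : Set E} {K p q : ℝ} (hp : 0 ≤ p) (hpq : p ≤ q)
    (hnear : f =O[𝓝[S] 0] fun ζ ↦ ‖ζ‖ ^ q) (hK : 0 ≤ K)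
    (hfar : ∀ ζ ∈ S, ‖f ζ‖ ≤ K * (1 + ‖ζ‖ ^ p)) : ∃ C, ∀ ζ ∈ S, ‖f ζ‖ ≤ C * ‖ζ‖ ^ q := by
  obtain ⟨C, hC⟩ := hnear.bound
  obtain ⟨δ, hδ, hball⟩ := Metric.mem_nhdsWithin_iff.1 hC
  refine ⟨max C (K * (1 + δ ^ p) / δ ^ q), fun ζ hζ ↦ ?_⟩
  rcases lt_or_ge ‖ζ‖ δ with hlt | hge
  · have h : ‖f ζ‖ ≤ C * ‖‖ζ‖ ^ q‖ := hball ⟨mem_ball_zero_iff.2 hlt, hζ⟩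
    rw [Real.norm_of_nonneg (by positivity)] at h
    exact h.trans (by gcongr; exact le_max_left _ _)
  · have hratio : 1 ≤ ‖ζ‖ / δ := (one_le_div hδ).2 hge
    calc ‖f ζ‖ ≤ K * (1 + ‖ζ‖ ^ p) := hfar ζ hζ
      _ = K * (1 + δ ^ p * (‖ζ‖ / δ) ^ p) := by
        rw [Real.div_rpow (norm_nonneg _) hδ.le, mul_div_cancel₀ _ (by positivity)]
      _ ≤ K * ((‖ζ‖ / δ) ^ q + δ ^ p * (‖ζ‖ / δ) ^ q) := by
        gcongr
        exact Real.one_le_rpow hratio (hp.trans hpq)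
      _ = K * (1 + δ ^ p) / δ ^ q * ‖ζ‖ ^ q := by
        rw [Real.div_rpow (norm_nonneg _) hδ.le]
        ring
      _ ≤ _ := by gcongr; exact le_max_right _ _

theorem norm_quasiCompactSymbol_le {α M : ℝ} (hα : 0 < α) {ζ : ℂ} (hζ : 0 ≤ ζ.re)
    (hζM : ζ.re ≤ M) :
    ‖quasiCompactSymbol α ζ‖ ≤ (1 + |coeffB α| * (1 + 2 + Real.exp M) +
      (|coeffMuOne α| * Real.exp M + |coeffMuZero α| + |coeffMuNegOne α|) * 2 ^ α) *
        (1 + ‖ζ‖ ^ α) := by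
  have hexp : ‖cexp ζ‖ ≤ Real.exp M := by rwa [norm_exp, Real.exp_le_exp]
  have hexp_neg : ‖cexp (-ζ)‖ ≤ 1 := by
    rwa [norm_exp, Real.exp_le_one_iff, neg_re, neg_nonpos]
  have hcompact : ‖1 + (coeffB α : ℂ) * (cexp (-ζ) - 2 + cexp ζ)‖ ≤
      1 + |coeffB α| * (1 + 2 + Real.exp M) := by
    refine (norm_add_le _ _).trans ?_
    rw [norm_one, norm_mul, norm_real, Real.norm_eq_abs]
    gcongr
    refine (norm_add_le _ _).trans (add_le_add ((norm_sub_le _ _).trans ?_) hexp)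
    simpa only [Complex.norm_ofNat] using add_le_add_left hexp_neg 2
  have hshift : ‖(coeffMuOne α : ℂ) * cexp ζ + coeffMuZero α + coeffMuNegOne α * cexp (-ζ)‖ ≤
      |coeffMuOne α| * Real.exp M + |coeffMuZero α| + |coeffMuNegOne α| := by
    refine norm_add₃_le.trans ?_
    simp only [norm_mul, norm_real, Real.norm_eq_abs]
    gcongr
    exact mul_le_of_le_one_right (abs_nonneg _) hexp_neg
  have hdiff : ‖(1 - cexp (-ζ)) ^ (α : ℂ)‖ ≤ 2 ^ α := by
    rw [norm_cpow_real]
    gcongr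
    exact (norm_sub_le _ _).trans (by rw [norm_one]; linarith)
  have hpow : 0 ≤ ‖ζ‖ ^ α := by positivity
  calc ‖quasiCompactSymbol α ζ‖
    _ ≤ (1 + |coeffB α| * (1 + 2 + Real.exp M)) * ‖ζ‖ ^ α +
        (|coeffMuOne α| * Real.exp M + |coeffMuZero α| + |coeffMuNegOne α|) * 2 ^ α := by
      refine (norm_sub_le _ _).trans ?_
      rw [norm_mul, norm_mul, norm_cpow_real]
      gcongr
    _ ≤ (1 + |coeffB α| * (1 + 2 + Real.exp M)) * (1 + ‖ζ‖ ^ α) +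
        (|coeffMuOne α| * Real.exp M + |coeffMuZero α| + |coeffMuNegOne α|) * 2 ^ α *
          (1 + ‖ζ‖ ^ α) := by
      exact add_le_add (mul_le_mul_of_nonneg_left (by linarith) (by positivity))
        (le_mul_of_one_le_right (by positivity) (by linarith))
    _ = _ := by ring

theorem exists_norm_quasiCompactSymbol_le {α : ℝ} (hα : 0 < α) (M : ℝ) :
    ∃ C, ∀ ζ : ℂ, 0 ≤ ζ.re → ζ.re ≤ M → ‖quasiCompactSymbol α ζ‖ ≤ C * ‖ζ‖ ^ (α + 4) := by
  have hnear : quasiCompactSymbol α =O[𝓝[{ζ : ℂ | 0 ≤ ζ.re ∧ ζ.re ≤ M}] 0]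
      fun ζ ↦ ‖ζ‖ ^ (α + 4) := by
    refine ((quasiCompactSymbol_isBigO α).mono
      (nhdsWithin_mono _ fun ζ hζ ↦ hζ.1)).norm_right.congr_right fun ζ ↦ ?_
    rw [norm_mul, norm_cpow_real, norm_pow, ← Real.rpow_natCast ‖ζ‖ 4,
      ← Real.rpow_add_of_nonneg (norm_nonneg _) hα.le (Nat.cast_nonneg _), Nat.cast_ofNat]
  obtain ⟨C, hC⟩ := exists_forall_mem_norm_le_mul_rpow hα.le (le_add_of_nonneg_right zero_le_four)
    hnear (by positivity) fun ζ hζ ↦ norm_quasiCompactSymbol_le hα hζ.1 hζ.2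
  exact ⟨C, fun ζ hζ hζM ↦ hC ζ ⟨hζ, hζM⟩⟩

end SymbolExpansion

section TruncationError

variable {α lam h r : ℝ} {u : ℝ → ℝ}

/-- The error at `x` with which the weighted combination of the shifted tempered Grünwald operators
reproduces the quasi-compact operator applied to the tempered derivative. -/
def truncationError (α lam h : ℝ) (u : ℝ → ℝ) (x : ℝ) : ℝ :=
  temperedP α lam h (leftTemperedRL α lam u) x -
    (coeffMuOne α * temperedGrunwald α lam h 1 u x +
      coeffMuZero α * temperedGrunwald α lam h 0 u x +
      coeffMuNegOne α * temperedGrunwald α lam h (-1) u x)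

theorem expMul_temperedP (hh : h ≠ 0) (v : ℝ → ℝ) (x : ℝ) :
    expMul lam (temperedP α lam h v) x = expMul lam v x + coeffB α *
      (expMul lam v (x + -h) - 2 * expMul lam v x + expMul lam v (x + h)) := by
  have hexp : Real.exp (lam * x) * Real.exp (-(lam * x)) = 1 := by
    rw [← Real.exp_add, add_neg_cancel, Real.exp_zero]
  rw [expMul, temperedP, centeredDiff, ← sub_eq_add_neg x h, neg_mul, mul_add, ← expMul]
  field_simp
  linear_combination (coeffB α * (expMul lam v (x - h) - 2 * expMul lam v x +
    expMul lam v (x + h))) * hexp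

theorem expMul_truncationError (hh : h ≠ 0) (x : ℝ) :
    expMul lam (truncationError α lam h u) x =
      expMul lam (leftTemperedRL α lam u) x + coeffB α *
        (expMul lam (leftTemperedRL α lam u) (x + -h) -
          2 * expMul lam (leftTemperedRL α lam u) x +
          expMul lam (leftTemperedRL α lam u) (x + h)) -
      (coeffMuOne α * expMul lam (temperedGrunwald α lam h 1 u) x +
        coeffMuZero α * expMul lam (temperedGrunwald α lam h 0 u) x +
        coeffMuNegOne α * expMul lam (temperedGrunwald α lam h (-1) u) x) := by
  rw [← expMul_temperedP hh]
  simp only [expMul, truncationError]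
  ring

theorem hasSymbol_expMul_truncationError (hα : 0 < α) (hαn : ∀ k : ℕ, (k : ℝ) ≠ α)
    (hlam : 0 ≤ lam) (hh : 0 < h) (hr : α + 1 < r) (hu : HasFourierDecay (fun x ↦ (u x : ℂ)) r) :
    HasSymbol lam (𝓕 fun x ↦ (u x : ℂ))
      (fun z ↦ ((h ^ α : ℝ) : ℂ)⁻¹ * quasiCompactSymbol α (z * h))
      fun x ↦ (expMul lam (truncationError α lam h u) x : ℂ) := by
  have hD := hasSymbol_expMul_leftTemperedRL hα hαn hlam hr hu
  have hP := hD.add ((((hD.translate (-h)).sub (hD.const_mul 2)).add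
    (hD.translate h)).const_mul (coeffB α : ℂ))
  have hG (p : ℤ) := hasSymbol_expMul_temperedGrunwald hα hαn hlam hh hu p
  have hM := (((hG 1).const_mul (coeffMuOne α : ℂ)).add ((hG 0).const_mul (coeffMuZero α : ℂ))).add
    ((hG (-1)).const_mul (coeffMuNegOne α : ℂ))
  simp only [expMul_truncationError hh.ne']
  push_cast
  refine (hP.sub hM).congr fun z hz _ ↦ ?_
  have hpow : (z * h) ^ (α : ℂ) = z ^ (α : ℂ) * ((h ^ α : ℝ) : ℂ) := by
    rw [mul_cpow_of_re_nonneg_of_re_pos (hlam.trans_eq hz.symm) (by simpa using hh),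
      ofReal_cpow hh.le]
  have hpos : ((h ^ α : ℝ) : ℂ) ≠ 0 := by exact_mod_cast (Real.rpow_pos_of_pos hh α).ne'
  rw [quasiCompactSymbol, hpow, mul_comm (h : ℂ) z]
  push_cast
  simp only [one_mul, zero_mul, neg_mul, mul_neg, Complex.exp_zero]
  field_simp

theorem exists_abs_truncationError_le (hα : 0 < α) (hαn : ∀ k : ℕ, (k : ℝ) ≠ α) (hlam : 0 ≤ lam)
    (hr : α + 5 < r) (hu : HasFourierDecay (fun x ↦ (u x : ℂ)) r) :
    ∃ C, ∀ h, 0 < h → h ≤ 1 → ∀ x, |truncationError α lam h u x| ≤ C * h ^ 4 := by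
  obtain ⟨C, hC⟩ := exists_norm_quasiCompactSymbol_le hα lam
  have hint := (hu.integrable_norm_rpow_mul (s := α + 4) (by linarith) (by linarith)
    (by linarith) lam).const_mul C
  refine ⟨∫ ω, C * (‖laplaceLine lam ω‖ ^ (α + 4) * ‖𝓕 (fun x ↦ (u x : ℂ)) ω‖),
    fun h hh hh1 x ↦ ?_⟩
  have hsymbol (ω : ℝ) : ‖((h ^ α : ℝ) : ℂ)⁻¹ * quasiCompactSymbol α (laplaceLine lam ω * h)‖ ≤
      C * ‖laplaceLine lam ω‖ ^ (α + 4) * h ^ 4 := by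
    have hle := hC (laplaceLine lam ω * h) (by simpa using by positivity)
      (by simpa using mul_le_of_le_one_right hlam hh1)
    rw [norm_mul, norm_real, Real.norm_of_nonneg hh.le,
      Real.mul_rpow (norm_nonneg _) hh.le, Real.rpow_add hh] at hle
    rw [norm_mul, norm_inv, norm_real, Real.norm_of_nonneg (by positivity),
      inv_mul_le_iff₀ (by positivity)]
    refine hle.trans_eq ?_
    norm_cast
    ring
  have hnorm := (hasSymbol_expMul_truncationError hα hαn hlam hh (by linarith) hu).norm_le
    (hint.mul_const (h ^ 4)) (fun ω ↦ ?_) x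
  · rw [integral_mul_const, norm_real, expMul, Real.norm_eq_abs, abs_mul, Real.abs_exp] at hnorm
    exact le_of_mul_le_mul_left hnorm (Real.exp_pos _)
  · rw [norm_mul]
    refine (mul_le_mul_of_nonneg_right (hsymbol ω) (norm_nonneg _)).trans_eq ?_
    ring

end TruncationError

theorem mainTheorem7_general (α lam : ℝ) (hα : 0 < α) (hαn : ∀ k : ℕ, (k : ℝ) ≠ α)
    (hlam : 0 ≤ lam) (u : ℝ → ℝ) (hu : ContDiff ℝ (rlOrder α + 5 : ℕ) u)
    (hL1 : ∀ k : ℕ, k ≤ rlOrder α + 5 → Integrable (iteratedDeriv k u)) :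
    LeftRLExists α (expMul lam u) ∧
    (∀ (p : ℤ) (h x : ℝ), 0 < h → Summable (grunwaldTerm α lam h p u x)) ∧
    ∃ C h₀ : ℝ, 0 < h₀ ∧ ∀ h : ℝ, 0 < h → h ≤ h₀ → ∀ x : ℝ,
      |temperedP α lam h (leftTemperedRL α lam u) x -
        (coeffMuOne α * temperedGrunwald α lam h 1 u x +
          coeffMuZero α * temperedGrunwald α lam h 0 u x +
          coeffMuNegOne α * temperedGrunwald α lam h (-1) u x)| ≤ C * h ^ 4 := by
  have hdecay := hasFourierDecay_of_contDiff (by omega) hu hL1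
  have hr : α + 5 < (rlOrder α + 5 : ℕ) := by
    push_cast
    linarith [rlOrder_sub_pos α]
  obtain ⟨C, hC⟩ := exists_abs_truncationError_le hα hαn hlam hr hdecay
  exact ⟨leftRLExists_expMul hα hαn hlam (by linarith) hdecay,
    fun p h x hh ↦ summable_grunwaldTerm hα hαn hlam hh hdecay p x, C, 1, one_pos, hC⟩

theorem rlOrder_eq_two {α : ℝ} (hα1 : 1 ≤ α) (hα2 : α < 2) : rlOrder α = 2 := by
  rw [rlOrder, (Nat.floor_eq_iff (n := 1) (zero_le_one.trans hα1)).2 (by norm_num [hα1, hα2])]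

theorem natCast_ne_of_one_lt_of_lt_two {α : ℝ} (hα1 : 1 < α) (hα2 : α < 2) (k : ℕ) :
    (k : ℝ) ≠ α := by
  rintro rfl
  have h1 : 1 < k := by exact_mod_cast hα1
  have h2 : k < 2 := by exact_mod_cast hα2
  omega

end

theorem mainTheorem7 (α lam : ℝ) (hα1 : 1 < α) (hα2 : α < 2) (hlam : 0 ≤ lam)
    (u : ℝ → ℝ) (hu : ContDiff ℝ 7 u)
    (hL1 : ∀ k : ℕ, k ≤ 7 → Integrable (iteratedDeriv k u)) :
    LeftRLExists α (expMul lam u) ∧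
    (∀ (p : ℤ) (h x : ℝ), 0 < h → Summable (grunwaldTerm α lam h p u x)) ∧
    ∃ C h₀ : ℝ, 0 < h₀ ∧ ∀ h : ℝ, 0 < h → h ≤ h₀ → ∀ x : ℝ,
      |temperedP α lam h (leftTemperedRL α lam u) x -
        (coeffMuOne α * temperedGrunwald α lam h 1 u x +
          coeffMuZero α * temperedGrunwald α lam h 0 u x +
          coeffMuNegOne α * temperedGrunwald α lam h (-1) u x)| ≤ C * h ^ 4 := by
  have horder : rlOrder α = 2 := rlOrder_eq_two hα1.le hα2
  exact mainTheorem7_general α lam (by linarith) (natCast_ne_of_one_lt_of_lt_two hα1 hα2) hlam u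
    (by rwa [horder]) (by rwa [horder])
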